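/- Let $P$ be a finite set of $n$ points in the plane in general position (no three collinear). For $0\le j\le n/2-1$, a $j$-edge of $P$ is a line through two points of $P$ that leaves exactly $j$ points of $P$ on one side; $E_j(P)$ is the number of $j$-edges, $E_{\le k}(P)=\sum_{j=0}^{k}E_j(P)$, and $E_{\le k}(n)$ is the minimum of $E_{\le k}(P)$ over all sets $P$ of $n$ points in general position. A simple allowable sequence on $[n]$ is a doubly infinite sequence $\Pi=(\dots,\pi_{-1},\pi_0,\pi_1,\dots)$ of permutations of $[n]=\{1,\dots,n\}$ such that any two consecutive permutations $\pi_i,\pi_{i+1}$ differ by a transposition of two elements in neighbouring positions and, for every $i$, $\pi_i$ is the reverse of $\pi_{i+\binom n2}$. Let $E_j(\Pi)$ be the number of transpositions that take place in positions $j+1,j+2$ or in positions $n-j-1,n-j$ among $\binom n2$ consecutive transpositions of $\Pi$ (this does not depend on where one starts), let $E_{\le k}(\Pi)=\sum_{j=0}^{k}E_j(\Pi)$, and let $\widetilde E_{\le k}(n)$ be the minimum of $E_{\le k}(\Pi)$ over all simple allowable sequences $\Pi$ on $[n]$. Let $m=\lceil(4n-11)/9\rceil$ and define $$u_{m-1}=3\binom{m+1}{2}+3\binom{m+1-\lfloor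 n/3\rfloor}{2}-3\left(m-\left\lfloor\frac n3\right\rfloor\right)\left(\frac n3-\left\lfloor\frac n3\right\rfloor\right),$$ $$u_k=\left\lceil\frac{1}{n-2k-2}\left(\binom n2+(n-2k-3)\,u_{k-1}\right)\right\rceil\qquad\text{for } m\le k\le\frac{n-3}{2}.$$ Theorem. For all integers $n$ and $k\ge 0$ with $m-1\le k\le (n-3)/2$, $$E_{\le k}(n)\ge u_k\qquad\text{and}\qquad \widetilde E_{\le k}(n)\ge u_k .$$ -/

import Mathlib

namespace KEdges

/-! ### Point sets in the plane -/

/-- The Euclidean plane. -/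
abbrev Plane : Type := EuclideanSpace ℝ (Fin 2)

/-- General position: no three distinct points of `P` are collinear. -/
def GeneralPosition (P : Finset Plane) : Prop :=
  ∀ p ∈ P, ∀ q ∈ P, ∀ r ∈ P, p ≠ q → p ≠ r → q ≠ r → ¬ Collinear ℝ {p, q, r}

/-- The point `r` lies strictly to the left of the line through `p` and `q` directed from `p`
to `q`. -/
def IsLeft (p q r : Plane) : Prop :=
  0 < (q 0 - p 0) * (r 1 - p 1) - (q 1 - p 1) * (r 0 - p 0)

open Classical in
/-- `E_k(P)`, the number of `k`-edges of `P`: lines through two points of `P` that leave exactly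
`k` points of `P` on one side. For `P` in general position such a line is the same thing as an
unordered pair `e = {p, q}` of points of `P`; as `p` and `q` may be exchanged, either side of the
line can be the side with `k` points. -/
noncomputable def pointEdges (P : Finset Plane) (k : ℕ) : ℕ :=
  ((P.powersetCard 2).filter
    (fun e => ∃ p q : Plane, e = {p, q} ∧ (P.filter (fun r => IsLeft p q r)).card = k)).card

/-- `E_{≤k}(P) = ∑_{j ≤ k} E_j(P)`. -/
noncomputable def pointEdgesLE (P : Finset Plane) (k : ℕ) : ℕ :=
  ∑ j ∈ Finset.range (k + 1), pointEdges P j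

/-- `E_{≤k}(n)`: the minimum of `E_{≤k}(P)` over all sets `P` of `n` points in general position. -/
noncomputable def minPointEdgesLE (n k : ℕ) : ℕ :=
  sInf {e | ∃ P : Finset Plane, P.card = n ∧ GeneralPosition P ∧ e = pointEdgesLE P k}

/-! ### Simple allowable sequences -/

/-- `ρ` arises from `σ` by transposing the elements in the neighbouring positions `i` and `i + 1`
(positions are numbered `1, …, n` here, and `σ p` is the element in the position with 0-based
index `p`). -/
def IsTranspositionAt {n : ℕ} (σ ρ : Equiv.Perm (Fin n)) (i : ℕ) : Prop :=
  ∃ a b : Fin n, (a : ℕ) + 1 = i ∧ (b : ℕ) = i ∧ ρ = σ * Equiv.swap a b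

/-- A simple allowable sequence on `n` elements: a doubly infinite sequence of permutations, any
two consecutive ones of which differ by a transposition of neighbouring elements, such that
`π_j` is the reverse of `π_{j + n(n-1)/2}` for every `j`. -/
structure AllowableSequence (n : ℕ) where
  perm : ℤ → Equiv.Perm (Fin n)
  step : ∀ j : ℤ, ∃ i : ℕ, IsTranspositionAt (perm j) (perm (j + 1)) i
  reverse : ∀ (j : ℤ) (p : Fin n), perm (j + (n.choose 2 : ℕ)) p = perm j (Fin.rev p)

/-- The transposition from `π_j` to `π_{j+1}` is a `k`-edge of the sequence, that is, a
`(k+1)`-critical transposition: it takes place in the positions `k + 1`, `k + 2` or in the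
positions `n - (k + 1)`, `n - (k + 1) + 1`. -/
def IsEdgeAt {n : ℕ} (S : AllowableSequence n) (k : ℕ) (j : ℤ) : Prop :=
  ∃ i : ℕ, IsTranspositionAt (S.perm j) (S.perm (j + 1)) i ∧ (i = k + 1 ∨ i + (k + 1) = n)

open Classical in
/-- The number of `(k+1)`-critical transpositions in the halfperiod that starts at `π_t`. -/
noncomputable def halfperiodEdges {n : ℕ} (S : AllowableSequence n) (t : ℤ) (k : ℕ) : ℕ :=
  ((Finset.range (n.choose 2)).filter (fun j : ℕ => IsEdgeAt S k (t + (j : ℤ)))).card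

/-- `E_k(Π)`: the number of `(k+1)`-critical transpositions in a halfperiod of `Π`
(all halfperiods give the same number, see `halfperiodEdges_eq`). -/
noncomputable def seqEdges {n : ℕ} (S : AllowableSequence n) (k : ℕ) : ℕ :=
  halfperiodEdges S 0 k

/-- `E_{≤k}(Π) = ∑_{j ≤ k} E_j(Π)`. -/
noncomputable def seqEdgesLE {n : ℕ} (S : AllowableSequence n) (k : ℕ) : ℕ :=
  ∑ j ∈ Finset.range (k + 1), seqEdges S j

/-- The minimum of `E_{≤k}(Π)` over all simple allowable sequences `Π` on `n` elements. -/
noncomputable def minSeqEdgesLE (n k : ℕ) : ℕ :=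
  sInf {e | ∃ S : AllowableSequence n, e = seqEdgesLE S k}

theorem IsEdgeAt.add_period {n : ℕ} {S : AllowableSequence n} {k : ℕ} {j : ℤ}
    (h : IsEdgeAt S k j) : IsEdgeAt S k (j + (n.choose 2 : ℕ)) := by
  obtain ⟨i, ⟨a, b, ha, hb, hab⟩, hi⟩ := h
  have hbn := b.isLt
  refine ⟨n - i, ⟨Fin.rev b, Fin.rev a, ?_, ?_, ?_⟩, ?_⟩
  · simp only [Fin.val_rev]; omega
  · simp only [Fin.val_rev]; omega
  · ext p
    have e1 : S.perm (j + (n.choose 2 : ℕ) + 1) p = S.perm (j + 1) (Fin.rev p) := by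
      rw [← S.reverse (j + 1) p]; congr 2; ring
    rw [e1, hab, Equiv.Perm.mul_apply, Equiv.Perm.mul_apply, S.reverse]
    congr 2
    simp only [Equiv.swap_apply_def]
    by_cases h1 : p = Fin.rev a
    · subst h1
      have : Fin.rev a ≠ Fin.rev b := by
        intro hh
        have := Fin.rev_injective hh
        subst this
        omega
      simp [this]
    · by_cases h2 : p = Fin.rev b
      · subst h2
        have : b ≠ a := by
          intro hh
          subst hh
          omega
        simp [this]
      · have h1' : Fin.rev p ≠ a := fun hh => h1 (by rw [← hh, Fin.rev_rev])
        have h2' : Fin.rev p ≠ b := fun hh => h2 (by rw [← hh, Fin.rev_rev])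
        simp [h1, h2, h1', h2']
  · omega

/-- All halfperiods contain the same number of `(k+1)`-critical transpositions. -/
theorem halfperiodEdges_eq {n : ℕ} (S : AllowableSequence n) (t : ℤ) (k : ℕ) :
    halfperiodEdges S t k = seqEdges S k := by
  classical
  have hper : ∀ t : ℤ, IsEdgeAt S k (t + (n.choose 2 : ℕ)) ↔ IsEdgeAt S k t := by
    intro t
    refine ⟨fun h => ?_, IsEdgeAt.add_period⟩
    obtain ⟨i', ⟨a', b', ha', hb', hab'⟩, hi'⟩ := h
    have hr : ∀ p, S.perm (t + 1) p = S.perm t (Equiv.swap (Fin.rev b') (Fin.rev a') p) := by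
      intro p
      have e1 : S.perm (t + 1) p = S.perm (t + (n.choose 2 : ℕ) + 1) (Fin.rev p) := by
        have := S.reverse (t + 1) (Fin.rev p)
        rw [Fin.rev_rev] at this
        rw [← this]; congr 2; ring
      rw [e1, hab', Equiv.Perm.mul_apply, S.reverse]
      congr 1
      simp only [Equiv.swap_apply_def]
      grind [Fin.rev_rev]
    have hbn := b'.isLt
    refine ⟨n - i', ⟨Fin.rev b', Fin.rev a', ?_, ?_, Equiv.ext hr⟩, ?_⟩
    · simp only [Fin.val_rev]; omega
    · simp only [Fin.val_rev]; omega
    · omega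
  have hstep : ∀ t : ℤ, halfperiodEdges S (t + 1) k = halfperiodEdges S t k := by
    intro t
    have h1 := Finset.sum_range_succ
      (fun j : ℕ => if IsEdgeAt S k (t + (j : ℤ)) then 1 else 0) (n.choose 2)
    rw [Finset.sum_range_succ'] at h1
    have h2 : ∀ j : ℕ, t + ((j + 1 : ℕ) : ℤ) = t + 1 + (j : ℤ) := by intro j; push_cast; ring
    simp only [h2, Nat.cast_zero, add_zero, hper] at h1
    simp only [halfperiodEdges, Finset.card_filter]
    omega
  unfold seqEdges
  induction t using Int.induction_on with
  | zero => rfl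
  | succ i ih => rw [hstep, ih]
  | pred i ih => rw [← ih, ← hstep (-(i : ℤ) - 1), sub_add_cancel]

/-! ### The recursive lower bound -/

/-- `m = ⌈(4n - 11)/9⌉`. -/
def startIndex (n : ℕ) : ℤ := ⌈(4 * (n : ℚ) - 11) / 9⌉

/-- `⌊n/3⌋` is `n / 3` in the natural numbers; the two binomial coefficients have nonnegative
upper entries for all `n ≥ 2`. -/
def startValue (n : ℕ) : ℚ :=
  3 * ((startIndex n + 1).toNat.choose 2 : ℚ)
    + 3 * ((startIndex n + 1 - ((n / 3 : ℕ) : ℤ)).toNat.choose 2 : ℚ)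
    - 3 * ((startIndex n : ℚ) - ((n / 3 : ℕ) : ℚ)) * ((n : ℚ) / 3 - ((n / 3 : ℕ) : ℚ))

/-- `uFrom n i = u_{m - 1 + i}`; the recursion is used for `k = m + i`. -/
def uFrom (n : ℕ) : ℕ → ℚ
  | 0 => startValue n
  | i + 1 =>
      (⌈1 / ((n : ℚ) - 2 * ((startIndex n : ℚ) + i) - 2) *
          ((n.choose 2 : ℚ) + ((n : ℚ) - 2 * ((startIndex n : ℚ) + i) - 3) * uFrom n i)⌉ : ℤ)

/-- The recursive sequence `u_k`, for `k ≥ m - 1`. -/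
def u (n : ℕ) (k : ℤ) : ℚ := uFrom n (k - (startIndex n - 1)).toNat

end KEdges

/-! Everything is proved for allowable sequences; points enter only through the sequence that lists
the pairs of points by slope, which has the same edge counts.

Start value. A transposition near the right end recurs near the left end a halfperiod later, so with
`K = k + 1` the number `E_{≤k}(Π)` counts the transpositions at the `K` leftmost levels during a
full period. This count makes sense inside any set `A` of elements, with levels measured within `A`.
Three elements of `A` can be removed so that at least `6K - 3` counted transpositions involve them,
and the levels below `K - 2` of the rest lie below level `K` of `A` (`exists_card_low_triple`). On
three time intervals one further level survives. An element that stays among the first `K - 1`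
throughout one interval cannot do so throughout another, since each two intervals contain times a
halfperiod apart; hence at least `3K - |A|` further transpositions are found there. Induction from
`(K, |A|)` to `(K - 2, |A| - 3)` gives `card_low_lower_bound`, whose value at `K = m` is `u_{m-1}`.

Recursion step. The transpositions not counted by `E_{≤k}` take place in the middle `n - 2k - 2`
positions. A pair transposed there either contains one of the `μ` elements that never leave the
center, which leaves at most `μ(n - 1)` pairs, or was brought together by one of the `E_k`
transpositions across the boundary, each of which serves at most `n - 2k - 3 - μ` pairs. This yields
`choose_two_le`: `binom(n,2) ≤ E_{≤k} + (n-2k-3) max(E_k, n-1)`. If `E_k ≥ n - 1`, substituting `E_k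
= E_{≤k} - E_{≤k-1}` gives exactly the recursion. Otherwise `E_{≤k} ≥ binom(n,2) - (n-2k-3)(n-1)`,
and `uFrom_succ_le` shows that `u_k` does not exceed the right-hand side. -/

namespace KEdges

/-- A property that holds at `s` and fails at `e` stops to hold at some step in between. -/
theorem exists_step_of_not {P : ℤ → Prop} {s e : ℤ} (hse : s ≤ e) (hs : P s) (he : ¬ P e) :
    ∃ t, s ≤ t ∧ t < e ∧ P t ∧ ¬ P (t + 1) := by
  by_contra! hcon
  have key : ∀ t, s ≤ t → t ≤ e → P t := by
    intro t hst
    induction t, hst using Int.leInduction with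
    | base => exact fun _ => hs
    | succ t hst ih => exact fun h => hcon t hst (by omega) (ih (by omega))
  exact he (key e hse le_rfl)

/-! ### Positions and transpositions in an allowable sequence. -/

namespace AllowableSequence

variable {n : ℕ} (S : AllowableSequence n)

/-- The length of a halfperiod. -/
abbrev half (_ : AllowableSequence n) : ℤ := (n.choose 2 : ℕ)

/-- The (0-based) position of the element `x` at time `t`. -/
def pos (t : ℤ) (x : Fin n) : ℕ := ((S.perm t).symm x : ℕ)

theorem pos_lt (t : ℤ) (x : Fin n) : S.pos t x < n := ((S.perm t).symm x).isLt

theorem pos_injective (t : ℤ) : Function.Injective (S.pos t) := fun _ _ h =>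
  (S.perm t).symm.injective (Fin.ext h)

theorem pos_inj {t : ℤ} {x y : Fin n} : S.pos t x = S.pos t y ↔ x = y :=
  (S.pos_injective t).eq_iff

theorem exists_pos_eq (t : ℤ) {i : ℕ} (hi : i < n) : ∃ x, S.pos t x = i :=
  ⟨S.perm t ⟨i, hi⟩, by simp [pos]⟩

theorem pos_add_half (t : ℤ) (x : Fin n) : S.pos (t + S.half) x + S.pos t x + 1 = n := by
  have h : (S.perm (t + S.half)).symm x = Fin.rev ((S.perm t).symm x) := by
    rw [Equiv.symm_apply_eq, S.reverse, Fin.rev_rev, Equiv.apply_symm_apply]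
  have := ((S.perm t).symm x).isLt
  simp only [pos, h, Fin.val_rev]
  omega

theorem pos_of_isTranspositionAt {t : ℤ} {i : ℕ}
    (h : IsTranspositionAt (S.perm t) (S.perm (t + 1)) i) :
    ∃ x y, S.pos t x + 1 = i ∧ S.pos t y = i ∧ S.pos (t + 1) x = i ∧ S.pos (t + 1) y + 1 = i ∧
      ∀ z, z ≠ x → z ≠ y → S.pos (t + 1) z = S.pos t z := by
  obtain ⟨a, b, ha, hb, hab⟩ := h
  have hsymm : ∀ z, (S.perm (t + 1)).symm z = Equiv.swap a b ((S.perm t).symm z) := by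
    intro z
    rw [Equiv.symm_apply_eq, hab]
    simp
  refine ⟨S.perm t a, S.perm t b, ?_, ?_, ?_, ?_, ?_⟩
  · simpa [pos] using ha
  · simpa [pos] using hb
  · simpa [pos, hsymm] using hb
  · simpa [pos, hsymm] using ha
  · intro z hza hzb
    simp only [pos, hsymm]
    rw [Equiv.swap_apply_of_ne_of_ne]
    · rintro rfl; simp at hza
    · rintro rfl; simp at hzb

theorem exists_swapped (t : ℤ) : ∃ p : Fin n × Fin n,
    S.pos t p.2 = S.pos t p.1 + 1 ∧ S.pos (t + 1) p.1 = S.pos t p.1 + 1 ∧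
      S.pos (t + 1) p.2 = S.pos t p.1 ∧
      ∀ z, z ≠ p.1 → z ≠ p.2 → S.pos (t + 1) z = S.pos t z := by
  obtain ⟨i, hi⟩ := S.step t
  obtain ⟨x, y, h1, h2, h3, h4, h5⟩ := S.pos_of_isTranspositionAt hi
  exact ⟨(x, y), by simp only; omega, by simp only; omega, by simp only; omega, h5⟩

/-- The element that moves to the right in the transposition from time `t` to time `t + 1`. -/
noncomputable def fst (t : ℤ) : Fin n := (S.exists_swapped t).choose.1

/-- The element that moves to the left in the transposition from time `t` to time `t + 1`. -/
noncomputable def snd (t : ℤ) : Fin n := (S.exists_swapped t).choose.2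

theorem pos_snd (t : ℤ) : S.pos t (S.snd t) = S.pos t (S.fst t) + 1 :=
  (S.exists_swapped t).choose_spec.1

theorem pos_succ_fst (t : ℤ) : S.pos (t + 1) (S.fst t) = S.pos t (S.fst t) + 1 :=
  (S.exists_swapped t).choose_spec.2.1

theorem pos_succ_snd (t : ℤ) : S.pos (t + 1) (S.snd t) = S.pos t (S.fst t) :=
  (S.exists_swapped t).choose_spec.2.2.1

theorem pos_succ_of_ne {t : ℤ} {z : Fin n} (h1 : z ≠ S.fst t) (h2 : z ≠ S.snd t) :
    S.pos (t + 1) z = S.pos t z :=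
  (S.exists_swapped t).choose_spec.2.2.2 z h1 h2

theorem fst_ne_snd (t : ℤ) : S.fst t ≠ S.snd t := by
  intro h
  have := S.pos_snd t
  rw [← h] at this
  omega

theorem pos_fst_of_isTranspositionAt {t : ℤ} {i : ℕ}
    (h : IsTranspositionAt (S.perm t) (S.perm (t + 1)) i) : S.pos t (S.fst t) + 1 = i := by
  obtain ⟨x, y, h1, h2, h3, h4, -⟩ := S.pos_of_isTranspositionAt h
  have hx : x = S.fst t := by
    by_contra hne
    by_cases hs : x = S.snd t
    · subst hs
      have := S.pos_snd t
      have := S.pos_succ_snd t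
      omega
    · have := S.pos_succ_of_ne hne hs
      omega
  rw [← hx, h1]

theorem isEdgeAt_iff {t : ℤ} {k : ℕ} :
    IsEdgeAt S k t ↔ S.pos t (S.fst t) = k ∨ S.pos t (S.fst t) + k + 2 = n := by
  constructor
  · rintro ⟨i, hi, h⟩
    have := S.pos_fst_of_isTranspositionAt hi
    omega
  · intro h
    obtain ⟨i, hi⟩ := S.step t
    have := S.pos_fst_of_isTranspositionAt hi
    exact ⟨i, hi, by omega⟩

/-- A step that changes the order of `x` and `y` transposes them. -/
theorem fst_snd_of_lt_of_not_lt {t : ℤ} {x y : Fin n} (h : S.pos t x < S.pos t y)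
    (h' : ¬ S.pos (t + 1) x < S.pos (t + 1) y) : S.fst t = x ∧ S.snd t = y := by
  have h1 := S.pos_snd t
  have h2 := S.pos_succ_fst t
  have h3 := S.pos_succ_snd t
  have hi : ∀ {u v : Fin n}, S.pos t u = S.pos t v → u = v := fun h => S.pos_injective t h
  have hne : S.pos t x ≠ S.pos t y := h.ne
  by_cases hxf : x = S.fst t
  · subst hxf
    refine ⟨rfl, ?_⟩
    by_contra hys
    have hyf : y ≠ S.fst t := fun e => hne (by rw [e])
    have := S.pos_succ_of_ne hyf (fun e => hys e.symm)
    have : S.pos t y ≠ S.pos t (S.snd t) := fun e => hys (hi e).symm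
    omega
  · exfalso
    by_cases hxs : x = S.snd t
    · subst hxs
      by_cases hyf : y = S.fst t
      · subst hyf; omega
      · have := S.pos_succ_of_ne hyf (fun e => hne (by rw [e]))
        omega
    · have h4 := S.pos_succ_of_ne hxf hxs
      by_cases hyf : y = S.fst t
      · subst hyf; omega
      · by_cases hys : y = S.snd t
        · subst hys
          have : S.pos t x ≠ S.pos t (S.fst t) := fun e => hxf (hi e)
          omega
        · have := S.pos_succ_of_ne hyf hys
          omega

theorem pos_lt_add_half_iff {t : ℤ} {x y : Fin n} :
    S.pos (t + S.half) x < S.pos (t + S.half) y ↔ S.pos t y < S.pos t x := by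
  have := S.pos_add_half t x
  have := S.pos_add_half t y
  omega

theorem half_nonneg : 0 ≤ S.half := by simp [half]

/-- The pair of elements that is transposed at time `t`. -/
noncomputable def pair (t : ℤ) : Finset (Fin n) := {S.fst t, S.snd t}

theorem pair_mem (t : ℤ) : S.pair t ∈ (Finset.univ : Finset (Fin n)).powersetCard 2 := by
  simp [pair, Finset.mem_powersetCard, Finset.card_pair (S.fst_ne_snd t)]

theorem exists_pair_eq (s : ℤ) {x y : Fin n} (hxy : x ≠ y) :
    ∃ t, s ≤ t ∧ t < s + S.half ∧ S.pair t = {x, y} := by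
  wlog h : S.pos s x < S.pos s y generalizing x y with H
  · rw [Finset.pair_comm]
    exact H hxy.symm (lt_of_le_of_ne (not_lt.1 h) fun e => hxy (S.pos_injective s e).symm)
  have h' : ¬ S.pos (s + S.half) x < S.pos (s + S.half) y := by
    rw [S.pos_lt_add_half_iff]; omega
  obtain ⟨t, h1, h2, h3, h4⟩ := exists_step_of_not
    (P := fun t => S.pos t x < S.pos t y) (by have := S.half_nonneg; omega) h h'
  obtain ⟨rfl, rfl⟩ := S.fst_snd_of_lt_of_not_lt h3 h4
  exact ⟨t, h1, h2, rfl⟩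

/-- In a halfperiod every pair of elements is transposed exactly once. -/
theorem pair_injOn (s : ℤ) : Set.InjOn S.pair (Finset.Ico s (s + S.half) : Finset ℤ) := by
  -- A halfperiod reverses the order, so each pair is transposed at least once; there are only as
  -- many steps as pairs.
  refine Finset.injOn_of_surjOn_of_card_le S.pair
    (t := (Finset.univ : Finset (Fin n)).powersetCard 2) (fun t _ => S.pair_mem t) ?_ ?_
  · intro e he
    obtain ⟨x, y, hxy, rfl⟩ := Finset.card_eq_two.1 (Finset.mem_powersetCard.1 he).2
    obtain ⟨t, h1, h2, h3⟩ := S.exists_pair_eq s hxy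
    exact ⟨t, by simp [h1, h2], h3⟩
  · simp [Finset.card_powersetCard, half]

/-- Returning to the old order would need a second transposition of the same pair within one
halfperiod. -/
theorem lt_of_lt_of_le {s t t' : ℤ} {x y : Fin n} (h : S.pos s x < S.pos s y) (hst : s ≤ t)
    (htt : t ≤ t') (ht' : t' ≤ s + S.half) (hyx : S.pos t y < S.pos t x) :
    S.pos t' y < S.pos t' x := by
  by_contra hcon
  obtain ⟨u, hu1, hu2, hu3, hu4⟩ := exists_step_of_not
    (P := fun t => S.pos t x < S.pos t y) hst h (by omega)
  obtain ⟨v, hv1, hv2, hv3, hv4⟩ := exists_step_of_not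
    (P := fun t => S.pos t y < S.pos t x) htt hyx hcon
  obtain ⟨e1, e2⟩ := S.fst_snd_of_lt_of_not_lt hu3 hu4
  obtain ⟨e3, e4⟩ := S.fst_snd_of_lt_of_not_lt hv3 hv4
  have he : S.pair u = S.pair v := by
    rw [pair, pair, e1, e2, e3, e4, Finset.pair_comm]
  have := S.pair_injOn s (Finset.mem_coe.2 (Finset.mem_Ico.2 ⟨hu1, by omega⟩))
    (Finset.mem_coe.2 (Finset.mem_Ico.2 ⟨by omega, by omega⟩)) he
  omega

/-! ### Ranks within a set of elements -/

/-- The number of elements of `A` that precede `x` at time `t`. -/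
def rk (A : Finset (Fin n)) (t : ℤ) (x : Fin n) : ℕ :=
  (A.filter fun z => S.pos t z < S.pos t x).card

variable {S} {A : Finset (Fin n)}

theorem rk_lt_rk {t : ℤ} {x y : Fin n} (hx : x ∈ A) (h : S.pos t x < S.pos t y) :
    S.rk A t x < S.rk A t y := by
  apply Finset.card_lt_card
  rw [Finset.ssubset_iff_of_subset]
  · exact ⟨x, by simp [hx, h], by simp⟩
  · intro z hz
    simp only [Finset.mem_filter] at hz ⊢
    exact ⟨hz.1, hz.2.trans h⟩

theorem rk_lt_card {t : ℤ} {x : Fin n} (hx : x ∈ A) : S.rk A t x < A.card := by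
  apply Finset.card_lt_card
  rw [Finset.ssubset_iff_of_subset (Finset.filter_subset _ _)]
  exact ⟨x, hx, by simp⟩

theorem rk_injOn (t : ℤ) : Set.InjOn (S.rk A t) A := by
  intro x hx y hy h
  by_contra hne
  rcases lt_or_gt_of_ne (fun e => hne (S.pos_injective t e)) with h' | h'
  · have := rk_lt_rk hx h'; omega
  · have := rk_lt_rk hy h'; omega

theorem image_rk (t : ℤ) : A.image (S.rk A t) = Finset.range A.card := by
  apply Finset.eq_of_subset_of_card_le
  · intro i hi
    obtain ⟨x, hx, rfl⟩ := Finset.mem_image.1 hi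
    exact Finset.mem_range.2 (rk_lt_card hx)
  · rw [Finset.card_image_of_injOn (rk_injOn t), Finset.card_range]

theorem exists_rk_eq (t : ℤ) {i : ℕ} (hi : i < A.card) : ∃ x ∈ A, S.rk A t x = i := by
  have : i ∈ A.image (S.rk A t) := by rw [image_rk]; simpa using hi
  simpa using this

theorem card_rk_lt (t : ℤ) {k : ℕ} (hk : k ≤ A.card) :
    (A.filter fun z => S.rk A t z < k).card = k := by
  have h1 : (A.filter fun z => S.rk A t z < k).image (S.rk A t) = Finset.range k := by
    ext i
    simp only [Finset.mem_image, Finset.mem_filter, Finset.mem_range]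
    constructor
    · rintro ⟨x, ⟨-, h⟩, rfl⟩; exact h
    · intro hi
      obtain ⟨x, hx, rfl⟩ := exists_rk_eq (S := S) (A := A) t (hi.trans_le hk)
      exact ⟨x, ⟨hx, hi⟩, rfl⟩
  rw [← Finset.card_image_of_injOn ((rk_injOn (S := S) (A := A) t).mono
    fun _ hz => (Finset.mem_filter.1 (Finset.mem_coe.1 hz)).1), h1,
    Finset.card_range]

theorem rk_add_half {t : ℤ} {x : Fin n} (hx : x ∈ A) :
    S.rk A (t + S.half) x + S.rk A t x + 1 = A.card := by
  have h1 : A = insert x ((A.filter fun z => S.pos t x < S.pos t z) ∪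
      (A.filter fun z => S.pos t z < S.pos t x)) := by
    ext z
    simp only [Finset.mem_insert, Finset.mem_union, Finset.mem_filter]
    constructor
    · intro hz
      rcases lt_trichotomy (S.pos t x) (S.pos t z) with h | h | h
      · exact .inr (.inl ⟨hz, h⟩)
      · exact .inl (S.pos_inj.1 h).symm
      · exact .inr (.inr ⟨hz, h⟩)
    · rintro (rfl | h | h)
      · exact hx
      · exact h.1
      · exact h.1
  have h2 := congrArg Finset.card h1
  rw [Finset.card_insert_of_notMem (by simp), Finset.card_union_of_disjoint] at h2
  · simp only [rk, S.pos_lt_add_half_iff]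
    omega
  · rw [Finset.disjoint_filter]
    intro z _ h h'
    omega

theorem rk_add_period {t : ℤ} {x : Fin n} (hx : x ∈ A) :
    S.rk A (t + 2 * S.half) x = S.rk A t x := by
  have h1 := rk_add_half (S := S) (t := t) hx
  have h2 := rk_add_half (S := S) (t := t + S.half) hx
  rw [show t + 2 * S.half = t + S.half + S.half by ring]
  omega

theorem rk_erase {q x : Fin n} (hq : q ∈ A) (t : ℤ) :
    S.rk A t x = S.rk (A.erase q) t x + if S.pos t q < S.pos t x then 1 else 0 := by
  simp only [rk, Finset.filter_erase]
  split_ifs with h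
  · rw [Finset.card_erase_add_one]
    simp [hq, h]
  · rw [Finset.erase_eq_of_notMem]
    · rfl
    · simp [h]

/-- Once an element is first, its rank increases for a halfperiod. -/
theorem rk_mono {s t t' : ℤ} {q : Fin n} (h0 : S.rk A s q = 0) (hst : s ≤ t) (htt : t ≤ t')
    (ht' : t' ≤ s + S.half) : S.rk A t q ≤ S.rk A t' q := by
  apply Finset.card_le_card
  intro z hz
  simp only [Finset.mem_filter] at hz ⊢
  refine ⟨hz.1, S.lt_of_lt_of_le ?_ hst htt ht' hz.2⟩
  have h1 : z ∉ A.filter fun z => S.pos s z < S.pos s q := by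
    rw [Finset.card_eq_zero.1 h0]; simp
  simp only [Finset.mem_filter, hz.1, true_and, not_lt] at h1
  exact h1.lt_of_ne fun e => hz.2.ne (by rw [S.pos_inj.1 e])

/-- Before an element becomes first, its rank decreases for a halfperiod. -/
theorem rk_anti {s t t' : ℤ} {q : Fin n} (hq : q ∈ A) (h0 : S.rk A s q = 0) (hst : s ≤ t + S.half)
    (htt : t ≤ t') (ht' : t' ≤ s) : S.rk A t' q ≤ S.rk A t q := by
  have h := rk_mono h0 hst (add_le_add_left htt _) (by omega)
  have h1 := rk_add_half (S := S) (t := t) hq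
  have h2 := rk_add_half (S := S) (t := t') hq
  omega

theorem rk_succ_of_ne {t : ℤ} {q : Fin n} (h1 : q ≠ S.fst t) (h2 : q ≠ S.snd t) :
    S.rk A (t + 1) q = S.rk A t q := by
  unfold rk
  congr 1
  apply Finset.filter_congr
  intro z _
  constructor
  · intro h
    by_contra hcon
    have hlt : S.pos t q < S.pos t z :=
      lt_of_le_of_ne (not_lt.1 hcon) fun e => h.ne (by rw [S.pos_inj.1 e])
    exact h1 (S.fst_snd_of_lt_of_not_lt hlt (by omega)).1.symm
  · intro h
    by_contra hcon
    exact h2 (S.fst_snd_of_lt_of_not_lt h hcon).2.symm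

theorem rk_succ_fst (t : ℤ) :
    S.rk A (t + 1) (S.fst t) = S.rk A t (S.fst t) + if S.snd t ∈ A then 1 else 0 := by
  have hstep := S.pos_succ_fst t
  have hs := S.pos_snd t
  have hs' := S.pos_succ_snd t
  have key : ∀ z, S.pos (t + 1) z < S.pos (t + 1) (S.fst t) ↔
      S.pos t z < S.pos t (S.fst t) ∨ z = S.snd t := by
    intro z
    by_cases hzs : z = S.snd t
    · subst hzs; simp; omega
    by_cases hzf : z = S.fst t
    · subst hzf; simp [hzs]
    rw [S.pos_succ_of_ne hzf hzs]
    have : S.pos t z ≠ S.pos t (S.fst t) := fun e => hzf (S.pos_injective t e)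
    simp only [hzs, or_false]
    omega
  unfold rk
  simp only [key, Finset.filter_or]
  rw [Finset.card_union_of_disjoint, Finset.filter_eq']
  · split_ifs <;> simp
  · rw [Finset.disjoint_filter]
    rintro z _ h rfl
    omega

theorem rk_snd (t : ℤ) :
    S.rk A t (S.snd t) = S.rk A t (S.fst t) + if S.fst t ∈ A then 1 else 0 := by
  have hs := S.pos_snd t
  have key : ∀ z, S.pos t z < S.pos t (S.snd t) ↔
      S.pos t z < S.pos t (S.fst t) ∨ z = S.fst t := by
    intro z
    rw [← S.pos_inj (t := t)]
    omega
  unfold rk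
  simp only [key, Finset.filter_or]
  rw [Finset.card_union_of_disjoint, Finset.filter_eq']
  · split_ifs <;> simp
  · rw [Finset.disjoint_filter]
    rintro z _ h rfl
    omega

theorem rk_succ_snd (t : ℤ) : S.rk A (t + 1) (S.snd t) = S.rk A t (S.fst t) := by
  have hstep := S.pos_succ_fst t
  have hs := S.pos_snd t
  have hs' := S.pos_succ_snd t
  have key : ∀ z, S.pos (t + 1) z < S.pos (t + 1) (S.snd t) ↔
      S.pos t z < S.pos t (S.fst t) := by
    intro z
    by_cases hzs : z = S.snd t
    · subst hzs; omega
    by_cases hzf : z = S.fst t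
    · subst hzf; omega
    rw [S.pos_succ_of_ne hzf hzs]
    omega
  unfold rk
  simp only [key]

/-- An element whose rank exceeds `j` after having been at most `j` overtakes an element of `A`
at the level `j`. -/
theorem exists_up {s e : ℤ} {q : Fin n} {j : ℕ} (hse : s ≤ e) (hs : S.rk A s q ≤ j)
    (he : j < S.rk A e q) :
    ∃ t, s ≤ t ∧ t < e ∧ S.fst t = q ∧ S.snd t ∈ A ∧ S.rk A t q = j ∧
      S.rk A (t + 1) q = j + 1 := by
  obtain ⟨t, h1, h2, h3, h4⟩ := exists_step_of_not
    (P := fun t => S.rk A t q ≤ j) hse hs (by omega)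
  have hf : S.fst t = q := by
    by_contra hf
    by_cases hq : q = S.snd t
    · subst hq
      rw [rk_succ_snd] at h4
      rw [rk_snd] at h3
      omega
    · rw [rk_succ_of_ne (fun e => hf e.symm) hq] at h4
      omega
  subst hf
  rw [rk_succ_fst] at h4
  have hmem : S.snd t ∈ A := by
    by_contra hmem
    simp only [hmem, if_false] at h4
    omega
  have h5 := rk_succ_fst (S := S) (A := A) t
  simp only [hmem, if_true] at h4 h5
  exact ⟨t, h1, h2, rfl, hmem, by omega, by omega⟩

/-- An element whose rank is at most `j` after having exceeded `j` is overtaken by an element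
of `A` at the level `j`. -/
theorem exists_down {s e : ℤ} {q : Fin n} {j : ℕ} (hse : s ≤ e) (hs : j < S.rk A s q)
    (he : S.rk A e q ≤ j) :
    ∃ t, s ≤ t ∧ t < e ∧ S.snd t = q ∧ S.fst t ∈ A ∧ S.rk A t (S.fst t) = j ∧
      S.rk A t q = j + 1 ∧ S.rk A (t + 1) q = j := by
  obtain ⟨t, h1, h2, h3, h4⟩ := exists_step_of_not
    (P := fun t => j < S.rk A t q) hse hs (by omega)
  have hf : S.snd t = q := by
    by_contra hf
    by_cases hq : q = S.fst t
    · subst hq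
      rw [rk_succ_fst] at h4
      omega
    · rw [rk_succ_of_ne hq (fun e => hf e.symm)] at h4
      omega
  subst hf
  rw [rk_succ_snd] at h4
  rw [rk_snd] at h3
  have hmem : S.fst t ∈ A := by
    by_contra hmem
    simp only [hmem, if_false] at h3
    omega
  have h5 := rk_snd (S := S) (A := A) t
  have h6 := rk_succ_snd (S := S) (A := A) t
  simp only [hmem, if_true] at h3 h5
  exact ⟨t, h1, h2, rfl, hmem, by omega, by omega, by omega⟩

end AllowableSequence

end KEdges

/-! ### Transpositions at low levels and the removal of three elements. -/

namespace KEdges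

open Finset in
theorem card_filter_Ico_succ {P : ℤ → Prop} [DecidablePred P] {T : ℤ} (hT : 0 ≤ T)
    (hP : ∀ t, P (t + T) ↔ P t) (c : ℤ) :
    #{t ∈ Ico (c + 1) (c + 1 + T) | P t} = #{t ∈ Ico c (c + T) | P t} := by
  have h1 : Ico c (c + T + 1) = insert c (Ico (c + 1) (c + 1 + T)) := by
    ext; simp only [mem_Ico, mem_insert]; omega
  have h2 : Ico c (c + T + 1) = insert (c + T) (Ico c (c + T)) := by
    ext; simp only [mem_Ico, mem_insert]; omega
  have h3 := congrArg (fun s : Finset ℤ => #{t ∈ s | P t}) (h1.symm.trans h2)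
  simp only [filter_insert, hP] at h3
  split_ifs at h3
  · rwa [card_insert_of_notMem (by simp), card_insert_of_notMem (by simp),
      Nat.add_right_cancel_iff] at h3
  · exact h3

/-- The number of times in a period at which a periodic property holds does not depend on where
the period starts. -/
theorem card_filter_Ico_periodic {P : ℤ → Prop} [DecidablePred P] {T : ℤ} (hT : 0 ≤ T)
    (hP : ∀ t, P (t + T) ↔ P t) (c c' : ℤ) :
    ((Finset.Ico c (c + T)).filter P).card = ((Finset.Ico c' (c' + T)).filter P).card := by
  have key : ∀ c, ((Finset.Ico c (c + T)).filter P).card =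
      ((Finset.Ico 0 (0 + T)).filter P).card := by
    intro c
    induction c using Int.induction_on with
    | zero => rfl
    | succ i ih => rw [card_filter_Ico_succ hT hP, ih]
    | pred i ih => rw [← ih, ← card_filter_Ico_succ hT hP, sub_add_cancel]
  rw [key c, key c']

namespace AllowableSequence

variable {n : ℕ} {S : AllowableSequence n} {A : Finset (Fin n)}

theorem fst_snd_add_half (t : ℤ) :
    S.fst (t + S.half) = S.snd t ∧ S.snd (t + S.half) = S.fst t := by
  apply S.fst_snd_of_lt_of_not_lt
  · rw [S.pos_lt_add_half_iff, S.pos_snd]; omega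
  · rw [show t + S.half + 1 = t + 1 + S.half by ring, S.pos_lt_add_half_iff, S.pos_succ_fst,
      S.pos_succ_snd]
    omega

theorem fst_add_period (t : ℤ) : S.fst (t + 2 * S.half) = S.fst t := by
  rw [show t + 2 * S.half = t + S.half + S.half by ring, (fst_snd_add_half _).1,
    (fst_snd_add_half _).2]

theorem snd_add_period (t : ℤ) : S.snd (t + 2 * S.half) = S.snd t := by
  rw [show t + 2 * S.half = t + S.half + S.half by ring, (fst_snd_add_half _).2,
    (fst_snd_add_half _).1]

variable (S) in
/-- The transpositions of elements of `A` in the period that starts at `c` that take place below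
the level `κ`, levels being counted within `A` from the left. -/
noncomputable def low (c : ℤ) (A : Finset (Fin n)) (κ : ℤ → ℤ) : Finset ℤ :=
  (Finset.Ico c (c + 2 * S.half)).filter fun t =>
    S.fst t ∈ A ∧ S.snd t ∈ A ∧ (S.rk A t (S.fst t) : ℤ) < κ t

theorem mem_low {c : ℤ} {κ : ℤ → ℤ} {t : ℤ} : t ∈ S.low c A κ ↔
    (c ≤ t ∧ t < c + 2 * S.half) ∧ S.fst t ∈ A ∧ S.snd t ∈ A ∧
      (S.rk A t (S.fst t) : ℤ) < κ t := by
  simp [low]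

theorem card_low_const (c c' : ℤ) (k : ℤ) :
    (S.low c A fun _ => k).card = (S.low c' A fun _ => k).card := by
  apply card_filter_Ico_periodic (by have := S.half_nonneg; omega)
  intro t
  rw [fst_add_period, snd_add_period]
  refine and_congr_right fun h => ?_
  rw [rk_add_period h]

/-- Removal of one element `q`, which overtakes on the levels below `M₁`, is overtaken on the
levels below `M₂`, and stays above the level `κ` as long as `κ` is not lowered. -/
theorem card_low_erase {c : ℤ} {κ κ' : ℤ → ℤ} {q : Fin n} {M₁ M₂ : ℕ} (hq : q ∈ A)
    (hup : ∀ j : ℕ, j < M₁ → ∃ t, (c ≤ t ∧ t < c + 2 * S.half) ∧ S.fst t = q ∧ S.snd t ∈ A ∧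
      S.rk A t (S.fst t) = j ∧ (j : ℤ) < κ t)
    (hdown : ∀ j : ℕ, j < M₂ → ∃ t, (c ≤ t ∧ t < c + 2 * S.half) ∧ S.snd t = q ∧ S.fst t ∈ A ∧
      S.rk A t (S.fst t) = j ∧ (j : ℤ) < κ t)
    (hκ : ∀ t, c ≤ t → t < c + 2 * S.half →
      κ' t + 1 ≤ κ t ∨ κ' t ≤ κ t ∧ κ t ≤ S.rk A t q) :
    M₁ + M₂ + (S.low c (A.erase q) κ').card ≤ (S.low c A κ).card := by
  set U := S.low c A κ with hU
  -- The transpositions supplied for different `j` are distinct because their levels differ.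
  have h1 : M₁ ≤ (U.filter fun t => S.fst t = q).card := by
    rw [← Finset.card_range M₁]
    refine (Finset.card_le_card ?_).trans
      (Finset.card_image_le (f := fun t => S.rk A t (S.fst t)))
    intro j hj
    obtain ⟨t, ht, h1, h2, h3, h4⟩ := hup j (Finset.mem_range.1 hj)
    refine Finset.mem_image.2 ⟨t, Finset.mem_filter.2 ⟨mem_low.2 ⟨ht, ?_, h2, ?_⟩, h1⟩, h3⟩
    · rw [h1]; exact hq
    · rw [h3]; exact h4
  have h2 : M₂ ≤ (U.filter fun t => S.snd t = q).card := by
    rw [← Finset.card_range M₂]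
    refine (Finset.card_le_card ?_).trans
      (Finset.card_image_le (f := fun t => S.rk A t (S.fst t)))
    intro j hj
    obtain ⟨t, ht, h1, h2, h3, h4⟩ := hdown j (Finset.mem_range.1 hj)
    refine Finset.mem_image.2 ⟨t, Finset.mem_filter.2 ⟨mem_low.2 ⟨ht, h2, ?_, ?_⟩, h1⟩, h3⟩
    · rw [h1]; exact hq
    · rw [h3]; exact h4
  -- Putting `q` back raises a level by one exactly when `q` precedes the transposed elements.
  -- Either `κ` has room for this, or `q` has rank at least `κ` and so cannot precede a
  -- transposition whose level in `A.erase q` is below `κ'`.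
  have h3 : S.low c (A.erase q) κ' ⊆ U := by
    intro t ht
    obtain ⟨hw, hf, hs, hlt⟩ := mem_low.1 ht
    have hfA := Finset.mem_of_mem_erase hf
    refine mem_low.2 ⟨hw, hfA, Finset.mem_of_mem_erase hs, ?_⟩
    have hr := rk_erase (S := S) (x := S.fst t) hq t
    split_ifs at hr with hpos
    · have := rk_lt_rk hq hpos
      rcases hκ t hw.1 hw.2 with h | h <;> omega
    · rcases hκ t hw.1 hw.2 with h | h <;> omega
  have hd1 : Disjoint (U.filter fun t => S.fst t = q) (U.filter fun t => S.snd t = q) := by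
    rw [Finset.disjoint_filter]
    intro t _ h h'
    exact S.fst_ne_snd t (h.trans h'.symm)
  have hd2 : Disjoint ((U.filter fun t => S.fst t = q) ∪ (U.filter fun t => S.snd t = q))
      (S.low c (A.erase q) κ') := by
    rw [Finset.disjoint_left]
    intro t ht ht'
    obtain ⟨-, hf, hs, -⟩ := mem_low.1 ht'
    rcases Finset.mem_union.1 ht with h | h
    · exact Finset.ne_of_mem_erase hf (Finset.mem_filter.1 h).2
    · exact Finset.ne_of_mem_erase hs (Finset.mem_filter.1 h).2
  have hsub : (U.filter fun t => S.fst t = q) ∪ (U.filter fun t => S.snd t = q) ∪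
      S.low c (A.erase q) κ' ⊆ U :=
    Finset.union_subset (Finset.union_subset (Finset.filter_subset _ _)
      (Finset.filter_subset _ _)) h3
  have := Finset.card_le_card hsub
  rw [Finset.card_union_of_disjoint hd2, Finset.card_union_of_disjoint hd1] at this
  omega

theorem exists_rk_eq_zero (hA : A.Nonempty) (t : ℤ) : ∃ x ∈ A, S.rk A t x = 0 :=
  exists_rk_eq t hA.card_pos

/-- Removal of an element that is first at some time. -/
theorem card_low_erase_first {K : ℕ} (hK : 1 ≤ K) (hA : 2 * K < A.card) :
    ∃ p ∈ A, ∃ c : ℤ, 2 * K + (S.low c (A.erase p)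
      fun t => if t < c + S.half then (K : ℤ) else K - 1).card ≤
        (S.low c A fun _ => (K : ℤ)).card := by
  have hh := S.half_nonneg
  obtain ⟨p, hp, hp0⟩ := exists_rk_eq_zero (S := S) (A := A)
    (Finset.card_pos.1 (by omega)) 0
  have hrev : ∀ t, S.rk A (t + S.half) p + S.rk A t p + 1 = A.card := fun t => rk_add_half hp
  have hrev2 : ∀ t, S.rk A (t + 2 * S.half) p = S.rk A t p := fun t => rk_add_period hp
  have h1 := hrev 0
  -- The period starts when `p`, first at time 0, has just reached rank `K`. During the next
  -- halfperiod its rank stays at least `K`, so the level need not be lowered; its `K` descents and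
  -- `K` ascents fall in the second halfperiod.
  obtain ⟨t, ht1, ht2, -, -, -, htK⟩ := exists_up (S := S) (A := A) (s := 0) (e := 0 + S.half)
    (q := p) (j := K - 1) (by omega) (by omega) (by omega)
  set c := t + 1 with hc
  rw [Nat.sub_add_cancel hK] at htK
  refine ⟨p, hp, c, ?_⟩
  rw [two_mul]
  apply card_low_erase hp
  · intro j hj
    obtain ⟨u, hu1, hu2, hu3, hu4, hu5, -⟩ := exists_up (S := S) (A := A) (s := 0 + 2 * S.half)
      (e := c + 2 * S.half) (q := p) (j := j) (by omega) (by rw [hrev2]; omega)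
      (by rw [hrev2]; omega)
    exact ⟨u, by omega, hu3, hu4, by rw [hu3, hu5], by exact_mod_cast hj⟩
  · intro j hj
    obtain ⟨u, hu1, hu2, hu3, hu4, hu5, -⟩ := exists_down (S := S) (A := A) (s := 0 + S.half)
      (e := 0 + 2 * S.half) (q := p) (j := j) (by omega) (by omega)
      (by rw [hrev2]; omega)
    exact ⟨u, by omega, hu3, hu4, hu5, by exact_mod_cast hj⟩
  · intro u hu1 hu2
    split_ifs with h
    · right
      refine ⟨le_rfl, ?_⟩
      rcases le_total u S.half with h' | h'
      · have := rk_mono (t := c) (t' := u) hp0 (by omega) hu1 (by omega)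
        omega
      · have h2 := rk_mono (t := u - S.half) (t' := c) hp0 (by omega) (by omega) (by omega)
        have h3 := hrev (u - S.half)
        rw [sub_add_cancel] at h3
        omega
    · left; omega

/-- The level that is left when three elements have been removed, of which each precedes all the
others for a halfperiod. -/
def tripleLevel (h c a b : ℤ) (K : ℤ) (t : ℤ) : ℤ :=
  if t < a ∨ (b ≤ t ∧ t < c + h) ∨ (a + h ≤ t ∧ t < b + h) then K - 1 else K - 2

end AllowableSequence
end KEdges

namespace KEdges
namespace AllowableSequence

variable {n : ℕ} {S : AllowableSequence n} {A : Finset (Fin n)}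

/-- An element `q` that starts the halfperiod in the middle and becomes first descends and ascends
through all `K` levels while the level is still `K`. In the second halfperiod it never gets below
rank `K - 1`, so removing it leaves the constant level `K - 1`. The second element to go is the one
that is first at `c + S.half` among the rest; it contributes `2 (K - 1)`, so this case even has one
transposition to spare. -/
theorem card_low_erase_two_of_center {B : Finset (Fin n)} {K : ℕ} (hK : 1 ≤ K)
    (hB : 2 * K ≤ B.card) (c : ℤ) {q : Fin n} (hq : q ∈ B) {s : ℤ} (hcs : c ≤ s)
    (hsc : s ≤ c + S.half) (hs : S.rk B s q = 0) (hq1 : K ≤ S.rk B c q)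
    (hq2 : S.rk B c q + 1 + K ≤ B.card) :
    ∃ D : Finset (Fin n), D.card + 2 = B.card ∧ ∃ a b : ℤ, c ≤ a ∧ a ≤ b ∧ b ≤ c + S.half ∧
      4 * K - 3 + (S.low c D (tripleLevel S.half c a b K)).card ≤
        (S.low c B fun t => if t < c + S.half then (K : ℤ) else K - 1).card := by
  have hh := S.half_nonneg
  have hrev : ∀ t, S.rk B (t + S.half) q + S.rk B t q + 1 = B.card := fun t => rk_add_half hq
  have hrevc := hrev c
  have step1 : K + K + (S.low c (B.erase q) fun _ => (K : ℤ) - 1).card ≤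
      (S.low c B fun t => if t < c + S.half then (K : ℤ) else K - 1).card := by
    apply card_low_erase hq
    · intro j hj
      obtain ⟨u, hu1, hu2, hu3, hu4, hu5, -⟩ := exists_up (S := S) (A := B) (s := s)
        (e := c + S.half) (q := q) (j := j) (by omega) (by omega) (by omega)
      refine ⟨u, by omega, hu3, hu4, by rw [hu3, hu5], ?_⟩
      rw [if_pos hu2]
      exact_mod_cast hj
    · intro j hj
      obtain ⟨u, hu1, hu2, hu3, hu4, hu5, -⟩ := exists_down (S := S) (A := B) (s := c)
        (e := s) (q := q) (j := j) (by omega) (by omega) (by omega)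
      refine ⟨u, by omega, hu3, hu4, hu5, ?_⟩
      rw [if_pos (by omega)]
      exact_mod_cast hj
    · intro u hu1 hu2
      split_ifs with h
      · left; omega
      · right
        refine ⟨le_rfl, ?_⟩
        have h3 := hrev (u - S.half)
        rw [sub_add_cancel] at h3
        rcases le_total (u - S.half) s with h' | h'
        · have := rk_anti (t := c) (t' := u - S.half) hq hs (by omega) (by omega) h'
          omega
        · have := rk_mono (t := u - S.half) (t' := c + S.half) hs h' (by omega) (by omega)
          omega
  have hC : (B.erase q).card + 1 = B.card := Finset.card_erase_add_one hq
  set C := B.erase q with hCdef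
  obtain ⟨r, hr, hr0⟩ := exists_rk_eq_zero (S := S) (A := C)
    (Finset.card_pos.1 (by omega)) (c + S.half)
  have hrrev : ∀ t, S.rk C (t + S.half) r + S.rk C t r + 1 = C.card := fun t => rk_add_half hr
  have hrc := hrrev c
  have hrc2 := hrrev (c + S.half)
  -- In `C` the element `r` has rank `K - 1` at `a + S.half`, hence rank at least `K - 1` at `a`;
  -- outside `[a, a + S.half)` it is not below the level. For `K = 1` it already has this rank at `c
  -- + S.half`.
  obtain ⟨a, ha1, ha2, haK⟩ : ∃ a, c ≤ a ∧ a ≤ c + S.half ∧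
      S.rk C (a + S.half) r = K - 1 := by
    rcases Nat.lt_or_ge K 2 with hK2 | hK2
    · exact ⟨c, le_rfl, by omega, by rw [hr0]; omega⟩
    · obtain ⟨t, ht1, ht2, -, -, -, htK⟩ := exists_up (S := S) (A := C) (s := c + S.half)
        (e := c + S.half + S.half) (q := r) (j := K - 2) (by omega) (by omega) (by omega)
      refine ⟨t + 1 - S.half, by omega, by omega, ?_⟩
      rw [sub_add_cancel, htK]
      omega
  have hra := hrrev a
  have step2 : K - 1 + (K - 1) + (S.low c (C.erase r)
      (tripleLevel S.half c a (c + S.half) K)).card ≤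
      (S.low c C fun _ => (K : ℤ) - 1).card := by
    apply card_low_erase hr
    · intro j hj
      obtain ⟨u, hu1, hu2, hu3, hu4, hu5, -⟩ := exists_up (S := S) (A := C) (s := c + S.half)
        (e := c + S.half + S.half) (q := r) (j := j) (by omega) (by omega) (by omega)
      exact ⟨u, by omega, hu3, hu4, by rw [hu3, hu5], by omega⟩
    · intro j hj
      obtain ⟨u, hu1, hu2, hu3, hu4, hu5, -⟩ := exists_down (S := S) (A := C) (s := c)
        (e := c + S.half) (q := r) (j := j) (by omega) (by omega) (by omega)
      exact ⟨u, by omega, hu3, hu4, hu5, by omega⟩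
    · intro u hu1 hu2
      unfold tripleLevel
      split_ifs with h
      · right
        refine ⟨le_rfl, ?_⟩
        rcases lt_or_ge u a with h' | h'
        · have := rk_anti (t := u) (t' := a) hr hr0 (by omega) (by omega) (by omega)
          omega
        · have := rk_mono (t := a + S.half) (t' := u) hr0 (by omega) (by omega) (by omega)
          omega
      · left; omega
  have hD : (C.erase r).card + 1 = C.card := Finset.card_erase_add_one hr
  exact ⟨C.erase r, by omega, a, c + S.half, ha1, ha2, le_rfl, by omega⟩

/-- Here `r` replaces `q` in the first place at step `s`, with `q` coming from the first `K` places
at time `c` and `r` from the last `K`. Removing `q` yields `K` ascents before the level drops, but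
only `K - 1` descents are guaranteed, as some may fall in the second halfperiod. Then `r` yields `K
- 1` each way, in total `4K - 3`. -/
theorem card_low_erase_two_of_consecutive {B : Finset (Fin n)} {K : ℕ} (hK : 1 ≤ K)
    (hB : 2 * K ≤ B.card) (c : ℤ) {q r : Fin n} (hq : q ∈ B) (hr : r ∈ B) {s : ℤ} (hcs : c ≤ s)
    (hsc : s < c + S.half) (hs : S.rk B s q = 0) (hs' : S.rk B (s + 1) r = 0)
    (hqK : S.rk B c q < K) (hrK : B.card ≤ S.rk B c r + K) :
    ∃ D : Finset (Fin n), D.card + 2 = B.card ∧ ∃ a b : ℤ, c ≤ a ∧ a ≤ b ∧ b ≤ c + S.half ∧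
      4 * K - 3 + (S.low c D (tripleLevel S.half c a b K)).card ≤
        (S.low c B fun t => if t < c + S.half then (K : ℤ) else K - 1).card := by
  have hh := S.half_nonneg
  have hqr : r ≠ q := by rintro rfl; omega
  have hrev : ∀ t, S.rk B (t + S.half) q + S.rk B t q + 1 = B.card := fun t => rk_add_half hq
  have hrevc := hrev c
  have hrevs := hrev s
  have hrev2 : ∀ t, S.rk B (t + 2 * S.half) q = S.rk B t q := fun t => rk_add_period hq
  -- At time `b` the element `q` has just reached rank `K`; at time `a` below, `r` has just come
  -- down to rank `K - 1`. Since `q` and `r` are first at `s` and `s + 1`, it follows that `a ≤ s +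
  -- 1 ≤ b`.
  obtain ⟨b', hb1, hb2, -, -, -, hbK⟩ := exists_up (S := S) (A := B) (s := s)
    (e := c + S.half) (q := q) (j := K - 1) (by omega) (by omega) (by omega)
  set b := b' + 1 with hb
  rw [Nat.sub_add_cancel hK] at hbK
  obtain ⟨a', ha1, ha2, -, -, -, haK, haK'⟩ := exists_down (S := S) (A := B) (s := c)
    (e := s + 1) (q := r) (j := K - 1) (by omega) (by omega) (by omega)
  set a := a' + 1 with ha
  rw [Nat.sub_add_cancel hK] at haK
  -- The given level, lowered by one except on `[b, b + S.half)`, where `q` is high enough not to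
  -- matter.
  set κ : ℤ → ℤ := fun t => if t < b then K - 1 else if t < c + S.half then K else
    if t < b + S.half then K - 1 else K - 2 with hκ
  have step1 : K + (K - 1) + (S.low c (B.erase q) κ).card ≤
      (S.low c B fun t => if t < c + S.half then (K : ℤ) else K - 1).card := by
    apply card_low_erase hq
    · intro j hj
      obtain ⟨u, hu1, hu2, hu3, hu4, hu5, -⟩ := exists_up (S := S) (A := B) (s := s)
        (e := b) (q := q) (j := j) (by omega) (by omega) (by omega)
      refine ⟨u, by omega, hu3, hu4, by rw [hu3, hu5], ?_⟩
      rw [if_pos (by omega)]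
      exact_mod_cast hj
    · intro j hj
      obtain ⟨u, hu1, hu2, hu3, hu4, hu5, -⟩ := exists_down (S := S) (A := B) (s := s - S.half)
        (e := s) (q := q) (j := j) (by omega) (by
          have := hrev (s - S.half)
          rw [sub_add_cancel] at this
          omega) (by omega)
      -- Descents before `c` are moved into the window by a full period. They land in the second
      -- halfperiod, where the level is `K - 1`.
      rcases lt_or_ge u c with h | h
      · refine ⟨u + 2 * S.half, by omega, by rw [snd_add_period, hu3], by
          rwa [fst_add_period], by rw [fst_add_period, rk_add_period hu4, hu5], ?_⟩
        split_ifs <;> omega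
      · refine ⟨u, by omega, hu3, hu4, hu5, ?_⟩
        split_ifs <;> omega
    · intro u hu1 hu2
      simp only [hκ]
      have hBb : S.rk B u q + S.rk B (u - S.half) q + 1 = B.card := by
        have := hrev (u - S.half)
        rwa [sub_add_cancel] at this
      split_ifs with h1 h2 h3 h4
      · left; omega
      · left; omega
      · right
        refine ⟨le_rfl, ?_⟩
        have := rk_mono (t := b) (t' := u) hs (by omega) (by omega) (by omega)
        omega
      · right
        refine ⟨le_rfl, ?_⟩
        rcases le_total (u - S.half) s with h' | h'
        · have := rk_anti (t := c) (t' := u - S.half) hq hs (by omega) (by omega) h'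
          omega
        · have := rk_mono (t := u - S.half) (t' := b) hs h' (by omega) (by omega)
          omega
      · left; omega
  have hC : (B.erase q).card + 1 = B.card := Finset.card_erase_add_one hq
  have hrB : ∀ t, S.rk (B.erase q) t r ≤ S.rk B t r ∧ S.rk B t r ≤ S.rk (B.erase q) t r + 1 := by
    intro t
    have := rk_erase (S := S) (x := r) hq t
    split_ifs at this <;> omega
  have hrrevB : ∀ t, S.rk B (t + S.half) r + S.rk B t r + 1 = B.card := fun t => rk_add_half hr
  set C := B.erase q with hCdef
  have hrC : r ∈ C := Finset.mem_erase.2 ⟨hqr, hr⟩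
  have hrrev : ∀ t, S.rk C (t + S.half) r + S.rk C t r + 1 = C.card := fun t => rk_add_half hrC
  have hlate : ∀ t, a ≤ t → t ≤ c + S.half → S.rk C t r + 1 ≤ K := by
    intro t h1 h2
    have h3 := (hrB t).1
    rcases le_total t (s + 1) with h | h
    · have := rk_anti (t := a) (t' := t) hr hs' (by omega) h1 h
      omega
    · have := rk_mono (t := t) (t' := c + S.half) hs' h h2 (by omega)
      have := hrrevB c
      omega
  have hrC0 : S.rk C (s + 1) r = 0 := by have := (hrB (s + 1)).1; omega
  have step2 : K - 1 + (K - 1) + (S.low c (C.erase r)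
      (tripleLevel S.half c a b K)).card ≤ (S.low c C κ).card := by
    apply card_low_erase hrC
    · intro j hj
      obtain ⟨u, hu1, hu2, hu3, hu4, hu5, -⟩ := exists_up (S := S) (A := C) (s := s + 1)
        (e := b + S.half) (q := r) (j := j) (by omega) (by omega) (by
          have := hlate b (by omega) (by omega)
          have := hrrev b
          omega)
      refine ⟨u, by omega, hu3, hu4, by rw [hu3, hu5], ?_⟩
      simp only [hκ]
      split_ifs <;> omega
    · intro j hj
      obtain ⟨u, hu1, hu2, hu3, hu4, hu5, -⟩ := exists_down (S := S) (A := C) (s := c)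
        (e := s + 1) (q := r) (j := j) (by omega) (by have := (hrB c).2; omega) (by omega)
      refine ⟨u, by omega, hu3, hu4, hu5, ?_⟩
      simp only [hκ]
      split_ifs <;> omega
    · intro u hu1 hu2
      have hsub : S.rk C u r + S.rk C (u - S.half) r + 1 = C.card := by
        have := hrrev (u - S.half)
        rwa [sub_add_cancel] at this
      -- On this arc `r` may be low and the level is lowered; elsewhere the rank of `r` is at least
      -- `κ`.
      by_cases harc : a ≤ u ∧ u < a + S.half
      · left
        simp only [hκ, tripleLevel]
        split_ifs <;> omega
      · right
        refine ⟨?_, ?_⟩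
        · simp only [hκ, tripleLevel]
          split_ifs <;> omega
        · rcases lt_or_ge u a with h | h
          · have h1 := rk_anti (t := u) (t' := a') hr hs' (by omega) (by omega) (by omega)
            have h2 := (hrB u).2
            simp only [hκ]
            split_ifs <;> omega
          · have h1 := hlate (u - S.half) (by omega) (by omega)
            simp only [hκ]
            split_ifs <;> omega
  have hD : (C.erase r).card + 1 = C.card := Finset.card_erase_add_one hrC
  exact ⟨C.erase r, by omega, a, b, by omega, by omega, by omega, by omega⟩

/-- If no element from the middle at time `c` becomes first during the halfperiod, the first place
passes at some step directly from an element of the first `K` to one of the last `K`. -/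
theorem card_low_erase_two {B : Finset (Fin n)} {K : ℕ} (hK : 1 ≤ K)
    (hB : 2 * K ≤ B.card) (c : ℤ) :
    ∃ D : Finset (Fin n), D.card + 2 = B.card ∧ ∃ a b : ℤ, c ≤ a ∧ a ≤ b ∧ b ≤ c + S.half ∧
      4 * K - 3 + (S.low c D (tripleLevel S.half c a b K)).card ≤
        (S.low c B fun t => if t < c + S.half then (K : ℤ) else K - 1).card := by
  have hh := S.half_nonneg
  have hne : B.Nonempty := Finset.card_pos.1 (by omega)
  by_cases hcen : ∃ q ∈ B, ∃ s, c ≤ s ∧ s ≤ c + S.half ∧ S.rk B s q = 0 ∧ K ≤ S.rk B c q ∧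
      S.rk B c q + 1 + K ≤ B.card
  · obtain ⟨q, hq, s, h1, h2, h3, h4, h5⟩ := hcen
    exact card_low_erase_two_of_center hK hB c hq h1 h2 h3 h4 h5
  push Not at hcen
  -- The property "the first element had rank below `K` at time `c`" holds at `c` and fails at `c +
  -- S.half`, where the first element is the one that was last at `c`.
  obtain ⟨s, hs1, hs2, ⟨q, hq, hq0, hqK⟩, hr⟩ := exists_step_of_not
    (P := fun t => ∃ q ∈ B, S.rk B t q = 0 ∧ S.rk B c q < K) (s := c) (e := c + S.half)
    (by omega) (by
      obtain ⟨q, hq, hq0⟩ := exists_rk_eq_zero (S := S) hne c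
      exact ⟨q, hq, hq0, by omega⟩) (by
      rintro ⟨q, hq, hq0, hqK⟩
      have := rk_add_half (S := S) (t := c) hq
      omega)
  obtain ⟨r, hrB, hr0⟩ := exists_rk_eq_zero (S := S) hne (s + 1)
  have hrK : K ≤ S.rk B c r := not_lt.1 fun h => hr ⟨r, hrB, hr0, h⟩
  have := hcen r hrB (s + 1) (by omega) (by omega) hr0 hrK
  exact card_low_erase_two_of_consecutive hK hB c hq hrB hs1 hs2 hq0 hr0 hqK (by omega)

/-- The elements of the first `k` places that are not always there leave it by a transposition
at level `k - 1`. -/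
theorem le_card_level {D : Finset (Fin n)} {k : ℕ} (hk : k ≤ D.card) (x y : ℤ) :
    k ≤ (D.filter fun z => ∀ t, x ≤ t → t ≤ y → S.rk D t z < k).card +
      ((Finset.Ico x y).filter fun t => S.fst t ∈ D ∧ S.snd t ∈ D ∧
        S.rk D t (S.fst t) + 1 = k).card := by
  set E := (Finset.Ico x y).filter fun t => S.fst t ∈ D ∧ S.snd t ∈ D ∧
        S.rk D t (S.fst t) + 1 = k with hE
  have hsub : (D.filter fun z => S.rk D x z < k) ⊆
      (D.filter fun z => ∀ t, x ≤ t → t ≤ y → S.rk D t z < k) ∪ E.image S.fst := by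
    intro z hz
    obtain ⟨hzD, hzk⟩ := Finset.mem_filter.1 hz
    by_cases hstay : ∀ t, x ≤ t → t ≤ y → S.rk D t z < k
    · exact Finset.mem_union_left _ (Finset.mem_filter.2 ⟨hzD, hstay⟩)
    · push Not at hstay
      obtain ⟨e, he1, he2, he3⟩ := hstay
      obtain ⟨t, ht1, ht2, ht3, ht4, ht5, -⟩ := exists_up (S := S) (A := D) (s := x) (e := e)
        (q := z) (j := k - 1) he1 (by omega) (by omega)
      refine Finset.mem_union_right _ (Finset.mem_image.2 ⟨t, ?_, ht3⟩)
      simp only [hE, Finset.mem_filter, Finset.mem_Ico, ht3]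
      exact ⟨⟨ht1, by omega⟩, hzD, ht4, by omega⟩
  have h1 := card_rk_lt (S := S) (A := D) x hk
  have h2 := Finset.card_le_card hsub
  have h3 := Finset.card_union_le
    (D.filter fun z => ∀ t, x ≤ t → t ≤ y → S.rk D t z < k) (E.image S.fst)
  have h4 : (E.image S.fst).card ≤ E.card := Finset.card_image_le
  omega

/-- Level `k - 1` is counted on three intervals only. On each, `le_card_level` gives at least `k`
minus the number of elements that stay among the first `k`. The three sets of staying elements are
disjoint: each two intervals, taken closed, contain times `x` and `x + S.half` (with `x` equal to
`c`, `a` or `b`), and `2 * k ≤ D.card` forbids being among the first `k` at both. -/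
theorem card_low_tripleLevel {D : Finset (Fin n)} {k : ℕ} (hk : 2 * k ≤ D.card) {a b c : ℤ}
    (hca : c ≤ a) (hab : a ≤ b) (hbc : b ≤ c + S.half) :
    (S.low c D fun _ => (k : ℤ) - 1).card + 3 * k ≤
      (S.low c D (tripleLevel S.half c a b (k + 1))).card + D.card := by
  have hh := S.half_nonneg
  have hrev : ∀ t, ∀ z ∈ D, S.rk D (t + S.half) z + S.rk D t z + 1 = D.card :=
    fun t z hz => rk_add_half hz
  set stay := fun x y : ℤ => D.filter fun z => ∀ t, x ≤ t → t ≤ y → S.rk D t z < k with hstay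
  set ev := fun x y : ℤ => (Finset.Ico x y).filter fun t => S.fst t ∈ D ∧ S.snd t ∈ D ∧
        S.rk D t (S.fst t) + 1 = k with hev
  have hle : ∀ x y, k ≤ (stay x y).card + (ev x y).card :=
    fun x y => le_card_level (by omega) x y
  have c1 := hle c a
  have c2 := hle b (c + S.half)
  have c3 := hle (a + S.half) (b + S.half)
  have d12 : Disjoint (stay c a) (stay b (c + S.half)) := by
    rw [Finset.disjoint_filter]
    intro z hz h1 h2
    have := h1 c (by omega) (by omega)
    have := h2 (c + S.half) (by omega) (by omega)
    have := hrev c z hz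
    omega
  have d3 : Disjoint (stay c a ∪ stay b (c + S.half)) (stay (a + S.half) (b + S.half)) := by
    rw [Finset.disjoint_union_left, Finset.disjoint_filter, Finset.disjoint_filter]
    constructor
    · intro z hz h1 h2
      have := h1 a (by omega) (by omega)
      have := h2 (a + S.half) (by omega) (by omega)
      have := hrev a z hz
      omega
    · intro z hz h1 h2
      have := h1 b (by omega) (by omega)
      have := h2 (b + S.half) (by omega) (by omega)
      have := hrev b z hz
      omega
  have hst : (stay c a ∪ stay b (c + S.half) ∪ stay (a + S.half) (b + S.half)).card ≤ D.card :=
    Finset.card_le_card (Finset.union_subset (Finset.union_subset (Finset.filter_subset _ _)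
      (Finset.filter_subset _ _)) (Finset.filter_subset _ _))
  rw [Finset.card_union_of_disjoint d3, Finset.card_union_of_disjoint d12] at hst
  have e0 : ∀ x y, ∀ t ∈ ev x y, x ≤ t ∧ t < y ∧ S.fst t ∈ D ∧ S.snd t ∈ D ∧
      S.rk D t (S.fst t) + 1 = k := by
    intro x y t ht
    simpa [hev, and_assoc] using ht
  have e12 : Disjoint (ev c a) (ev b (c + S.half)) := by
    rw [Finset.disjoint_left]
    intro t h1 h2
    have := e0 _ _ t h1
    have := e0 _ _ t h2
    omega
  have e3 : Disjoint (ev c a ∪ ev b (c + S.half)) (ev (a + S.half) (b + S.half)) := by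
    rw [Finset.disjoint_union_left, Finset.disjoint_left, Finset.disjoint_left]
    constructor
    · intro t h1 h2
      have := e0 _ _ t h1
      have := e0 _ _ t h2
      omega
    · intro t h1 h2
      have := e0 _ _ t h1
      have := e0 _ _ t h2
      omega
  have elow : Disjoint (S.low c D fun _ => (k : ℤ) - 1)
      (ev c a ∪ ev b (c + S.half) ∪ ev (a + S.half) (b + S.half)) := by
    rw [Finset.disjoint_left]
    intro t h1 h2
    have h3 := (mem_low.1 h1).2.2.2
    simp only [Finset.mem_union] at h2
    rcases h2 with (h2 | h2) | h2 <;> have := e0 _ _ t h2 <;> omega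
  have hsub : (S.low c D fun _ => (k : ℤ) - 1) ∪
      (ev c a ∪ ev b (c + S.half) ∪ ev (a + S.half) (b + S.half)) ⊆
      S.low c D (tripleLevel S.half c a b (k + 1)) := by
    intro t ht
    rw [Finset.mem_union] at ht
    rcases ht with ht | ht
    · obtain ⟨h1, h2, h3, h4⟩ := mem_low.1 ht
      refine mem_low.2 ⟨h1, h2, h3, ?_⟩
      unfold tripleLevel
      split_ifs <;> omega
    · simp only [Finset.mem_union] at ht
      rcases ht with (ht | ht) | ht <;> obtain ⟨h1, h2, h3, h4, h5⟩ := e0 _ _ t ht <;>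
      · refine mem_low.2 ⟨by omega, h3, h4, ?_⟩
        unfold tripleLevel
        rw [if_pos (by omega)]
        omega
  have hfin := Finset.card_le_card hsub
  rw [Finset.card_union_of_disjoint elow, Finset.card_union_of_disjoint e3,
    Finset.card_union_of_disjoint e12] at hfin
  omega

/-- Removal of three elements. -/
theorem exists_card_low_triple {K : ℕ} (hK : 1 ≤ K) (hA : 2 * K < A.card) :
    ∃ D : Finset (Fin n), D.card + 3 = A.card ∧ ∃ c : ℤ,
      6 * K - 3 + (3 * K - A.card) + (S.low c D fun _ => (K : ℤ) - 2).card ≤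
        (S.low 0 A fun _ => (K : ℤ)).card := by
  obtain ⟨p, hp, c, h1⟩ := card_low_erase_first (S := S) hK hA
  have hB := Finset.card_erase_add_one hp
  obtain ⟨D, hD, a, b, hca, hab, hbc, h2⟩ := card_low_erase_two (S := S) hK
    (B := A.erase p) (by omega) c
  have h3 := card_low_tripleLevel (S := S) (D := D) (k := K - 1) (by omega) hca hab hbc
  have e1 : ((K - 1 : ℕ) : ℤ) + 1 = K := by omega
  have e2 : ((K - 1 : ℕ) : ℤ) - 1 = K - 2 := by omega
  rw [e1, e2] at h3
  -- This covers the case `3 * K < A.card`, in which the truncated difference `3 * K - A.card` is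
  -- zero.
  have h4 : (S.low c D fun _ => (K : ℤ) - 2).card ≤
      (S.low c D (tripleLevel S.half c a b K)).card := by
    apply Finset.card_le_card
    intro t ht
    obtain ⟨h1, h2, h3, h4⟩ := mem_low.1 ht
    refine mem_low.2 ⟨h1, h2, h3, ?_⟩
    unfold tripleLevel
    split_ifs <;> omega
  rw [card_low_const 0 c]
  exact ⟨D, by omega, c, by omega⟩

/-- Passing to `D` lowers `K` by 2 and `A.card / 3` by 1 and keeps the residue, so the excess `K -
A.card / 3` drops by 1. The gain `6K - 3` accounts for the term `3K(K+1)`, the gain `3K - A.card`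
for the two terms in the excess. -/
theorem card_low_lower_bound (K : ℕ) : ∀ A : Finset (Fin n), 2 * K < A.card →
    (3 * K * (K + 1) : ℤ) ≤ 2 * (S.low 0 A fun _ => (K : ℤ)).card ∧
    (A.card / 3 ≤ K → (3 * K * (K + 1) + 3 * (K - (A.card / 3 : ℕ)) * (K - (A.card / 3 : ℕ) + 1)
      - 2 * (K - (A.card / 3 : ℕ)) * (A.card % 3 : ℕ) : ℤ) ≤
        2 * (S.low 0 A fun _ => (K : ℤ)).card) := by
  induction K using Nat.strong_induction_on with
  | _ K ih =>
    intro A hA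
    rcases Nat.eq_zero_or_pos K with rfl | hK
    · refine ⟨by simp, fun h => ?_⟩
      have h0 : A.card / 3 = 0 := by omega
      rw [h0]; simp
    obtain ⟨D, hD, c, hc⟩ := exists_card_low_triple (S := S) hK hA
    rcases Nat.lt_or_ge K 2 with hK2 | hK2
    · obtain rfl : K = 1 := by omega
      have h3 : (3 : ℤ) ≤ (S.low 0 A fun _ => ((1 : ℕ) : ℤ)).card := by omega
      refine ⟨by push_cast at *; linarith, fun h => ?_⟩
      have h0 : A.card / 3 = 1 := by omega
      rw [h0]
      push_cast at *
      linarith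
    · obtain ⟨k, rfl⟩ : ∃ k, K = k + 2 := ⟨K - 2, by omega⟩
      have e : (((k + 2 : ℕ) : ℤ) - 2) = (k : ℤ) := by push_cast; ring
      rw [e, card_low_const c 0] at hc
      obtain ⟨i1, i2⟩ := ih k (by omega) D (by omega)
      have q1 : (D.card / 3 : ℕ) + 1 = A.card / 3 := by omega
      have q2 : D.card % 3 = A.card % 3 := by omega
      have q3 : 3 * (A.card / 3) + A.card % 3 = A.card := Nat.div_add_mod _ _
      have q4 : A.card % 3 < 3 := Nat.mod_lt _ (by omega)
      rw [q2] at i2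
      set F := (S.low 0 A fun _ => ((k + 2 : ℕ) : ℤ)).card
      set G := (S.low 0 D fun _ => (k : ℤ)).card
      set t := A.card / 3
      set ρ := A.card % 3
      have hF : (6 * (k + 2) - 3 + G : ℤ) ≤ F := by omega
      have first : (3 * ((k + 2 : ℕ) : ℤ) * ((k + 2 : ℕ) + 1) : ℤ) ≤ 2 * F := by
        push_cast; nlinarith
      refine ⟨first, fun h => ?_⟩
      -- If the excess is zero, the second bound is the first; the induction hypothesis for the
      -- second bound would not apply to `D`.
      rcases h.lt_or_eq with h' | h'
      · have i3 := i2 (by omega)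
        have q5 : ((D.card / 3 : ℕ) : ℤ) = t - 1 := by omega
        rw [q5] at i3
        have hF2 : (6 * (k + 2) - 3 + (3 * (k + 2) - 3 * t - ρ) + G : ℤ) ≤ F := by omega
        push_cast
        nlinarith
      · have : ((k + 2 : ℕ) : ℤ) - (t : ℕ) = 0 := by omega
        rw [this]
        linarith

end AllowableSequence
end KEdges

/-! ### Edge counts of a sequence and transpositions in the middle positions. -/

namespace KEdges
namespace AllowableSequence

variable {n : ℕ} {S : AllowableSequence n}

theorem rk_univ (t : ℤ) (x : Fin n) : S.rk Finset.univ t x = S.pos t x := by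
  rw [rk, pos, ← Fin.card_Iio]
  apply Finset.card_equiv (S.perm t).symm
  intro z
  simp [pos]

theorem pos_fst_add_half (t : ℤ) :
    S.pos (t + S.half) (S.fst (t + S.half)) + S.pos t (S.fst t) + 2 = n := by
  have h1 := S.pos_add_half t (S.snd t)
  have h2 := S.pos_snd t
  rw [(fst_snd_add_half t).1]
  omega

theorem pos_fst_add_two_le (t : ℤ) : S.pos t (S.fst t) + 2 ≤ n := by
  have h1 := S.pos_lt t (S.snd t)
  have h2 := S.pos_snd t
  omega

/-! ### Counting edges in a halfperiod -/

theorem seqEdges_eq (k : ℕ) : seqEdges S k =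
    ((Finset.Ico 0 S.half).filter fun t =>
      S.pos t (S.fst t) = k ∨ S.pos t (S.fst t) + k + 2 = n).card := by
  classical
  unfold seqEdges halfperiodEdges
  refine Finset.card_bij (fun j _ => (j : ℤ)) ?_ ?_ ?_
  · intro j hj
    simp only [Finset.mem_filter, Finset.mem_range, zero_add, isEdgeAt_iff] at hj
    simp only [Finset.mem_filter, Finset.mem_Ico, half]
    exact ⟨by omega, hj.2⟩
  · intro i _ j _ h
    exact_mod_cast h
  · intro t ht
    simp only [Finset.mem_filter, Finset.mem_Ico, half] at ht
    lift t to ℕ using ht.1.1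
    refine ⟨t, ?_, rfl⟩
    simp only [Finset.mem_filter, Finset.mem_range, zero_add, isEdgeAt_iff]
    exact ⟨by omega, ht.2⟩

theorem seqEdgesLE_eq (k : ℕ) (hk : 2 * k + 2 < n) : seqEdgesLE S k =
    ((Finset.Ico 0 S.half).filter fun t =>
      S.pos t (S.fst t) ≤ k ∨ n ≤ S.pos t (S.fst t) + k + 2).card := by
  induction k with
  | zero =>
    rw [seqEdgesLE, zero_add, Finset.sum_range_one, seqEdges_eq]
    congr 1
    apply Finset.filter_congr
    intro t _
    have := S.pos_fst_add_two_le t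
    omega
  | succ k ih =>
    rw [seqEdgesLE, Finset.sum_range_succ, ← seqEdgesLE, ih (by omega), seqEdges_eq,
      ← Finset.card_union_of_disjoint, ← Finset.filter_or]
    · congr 1
      apply Finset.filter_congr
      intro t _
      omega
    · rw [Finset.disjoint_filter]
      intro t _
      omega

/-- The left-hand transpositions of the second halfperiod are the right-hand ones of the first,
shifted by `S.half`. -/
theorem card_low_univ (k : ℕ) (hk : 2 * k + 2 < n) :
    (S.low 0 Finset.univ fun _ => ((k + 1 : ℕ) : ℤ)).card = seqEdgesLE S k := by
  have hh := S.half_nonneg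
  have h1 : S.low 0 Finset.univ (fun _ => ((k + 1 : ℕ) : ℤ)) =
      ((Finset.Ico 0 S.half).filter fun t => S.pos t (S.fst t) ≤ k) ∪
      ((Finset.Ico 0 S.half).filter fun t => n ≤ S.pos t (S.fst t) + k + 2).map
        (addRightEmbedding S.half) := by
    ext t
    simp only [mem_low, Finset.mem_univ, true_and, rk_univ, Finset.mem_union, Finset.mem_map,
      Finset.mem_filter, Finset.mem_Ico, addRightEmbedding_apply]
    constructor
    · rintro ⟨⟨h1, h2⟩, h3⟩
      rcases lt_or_ge t S.half with h | h
      · exact .inl ⟨⟨h1, h⟩, by omega⟩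
      · have := pos_fst_add_half (S := S) (t - S.half)
        rw [sub_add_cancel] at this
        exact .inr ⟨t - S.half, ⟨⟨by omega, by omega⟩, by omega⟩, by ring⟩
    · rintro (⟨⟨h1, h2⟩, h3⟩ | ⟨u, ⟨⟨h1, h2⟩, h3⟩, rfl⟩)
      · exact ⟨⟨h1, by omega⟩, by omega⟩
      · have := pos_fst_add_half (S := S) u
        exact ⟨⟨by omega, by omega⟩, by omega⟩
  rw [seqEdgesLE_eq k hk, h1, Finset.card_union_of_disjoint, Finset.card_map, Finset.filter_or,
    Finset.card_union_of_disjoint]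
  · rw [Finset.disjoint_filter]
    intro t _
    omega
  · rw [Finset.disjoint_left]
    intro t h1 h2
    simp only [Finset.mem_map, Finset.mem_filter, Finset.mem_Ico, addRightEmbedding_apply] at h1 h2
    obtain ⟨u, h3, rfl⟩ := h2
    omega

/-! ### Transpositions in the center -/

variable (S) in
/-- The elements in the middle `n - 2K` positions at time `t`. -/
def center (K : ℕ) (t : ℤ) : Finset (Fin n) :=
  Finset.univ.filter fun x => K ≤ S.pos t x ∧ S.pos t x + K < n

theorem mem_center {K : ℕ} {t : ℤ} {x : Fin n} :
    x ∈ S.center K t ↔ K ≤ S.pos t x ∧ S.pos t x + K < n := by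
  simp [center]

theorem card_center (K : ℕ) (t : ℤ) : (S.center K t).card = n - 2 * K := by
  have h : (S.center K t).image (S.pos t) = Finset.Ico K (n - K) := by
    ext i
    simp only [Finset.mem_image, mem_center, Finset.mem_Ico]
    constructor
    · rintro ⟨x, h, rfl⟩; omega
    · intro hi
      obtain ⟨x, rfl⟩ := S.exists_pos_eq t (i := i) (by omega)
      exact ⟨x, by omega, rfl⟩
  rw [← Finset.card_image_of_injective _ (S.pos_injective t), h, Nat.card_Ico]
  omega

theorem center_add_half (K : ℕ) (t : ℤ) : S.center K (t + S.half) = S.center K t := by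
  ext x
  have := S.pos_add_half t x
  simp only [mem_center]
  omega

theorem center_add_mul_half (K : ℕ) (t m : ℤ) : S.center K (t + m * S.half) = S.center K t :=
  (Function.Periodic.int_mul (f := S.center K) (c := S.half) (center_add_half K) m) t

variable (S) in
/-- The element that enters the center in a transposition that crosses its boundary. -/
noncomputable def entering (K : ℕ) (t : ℤ) : Fin n :=
  if S.pos t (S.fst t) + 1 = K then S.fst t else S.snd t

variable (S) in
/-- The transposition at time `t` crosses the boundary of the center. -/
def Crosses (K : ℕ) (t : ℤ) : Prop :=
  S.pos t (S.fst t) + 1 = K ∨ S.pos t (S.fst t) + 1 + K = n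

theorem crosses_of_enters {K : ℕ} {t : ℤ} {x : Fin n} (h : x ∉ S.center K t)
    (h' : x ∈ S.center K (t + 1)) : S.Crosses K t ∧ x = S.entering K t := by
  rw [mem_center] at h h'
  have h1 := S.pos_snd t
  have h2 := S.pos_succ_fst t
  have h3 := S.pos_succ_snd t
  unfold entering Crosses
  by_cases hf : x = S.fst t
  · subst hf
    have : S.pos t (S.fst t) + 1 = K := by omega
    simp [this]
  by_cases hs : x = S.snd t
  · subst hs
    rw [if_neg (by omega)]
    exact ⟨by omega, rfl⟩
  · rw [S.pos_succ_of_ne hf hs] at h'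
    exact absurd h' h

theorem crosses_add_half {K : ℕ} {t : ℤ} : S.Crosses K (t + S.half) ↔ S.Crosses K t := by
  have h1 := pos_fst_add_half (S := S) t
  unfold Crosses
  omega

theorem entering_add_half {K : ℕ} {t : ℤ} (h : S.Crosses K t) (hK : 2 * K < n) :
    S.entering K (t + S.half) = S.entering K t := by
  have h1 := pos_fst_add_half (S := S) t
  unfold entering
  rcases h with h | h
  · rw [if_pos h, if_neg (by omega), (fst_snd_add_half t).2]
  · rw [if_neg (by omega : ¬ S.pos t (S.fst t) + 1 = K), if_pos (by omega),
      (fst_snd_add_half t).1]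

theorem entering_mem {K : ℕ} {t : ℤ} (h : S.Crosses K t) (hK : 2 * K < n) :
    S.entering K t ∈ S.center K (t + 1) ∧ S.entering K t ∉ S.center K t := by
  have h1 := S.pos_snd t
  have h2 := S.pos_succ_fst t
  have h3 := S.pos_succ_snd t
  unfold Crosses at h
  simp only [mem_center, entering]
  split_ifs <;> omega

theorem exists_crosses {K : ℕ} (hK1 : 1 ≤ K) (hK : 2 * K < n) :
    ∃ t, 0 ≤ t ∧ t < S.half ∧ S.Crosses K t := by
  obtain ⟨x, hx⟩ := S.exists_pos_eq 0 (i := 0) (by omega)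
  have h := S.pos_add_half 0 x
  rw [zero_add] at h
  obtain ⟨t, h1, h2, h3, -, h4, -⟩ := exists_up (S := S) (A := Finset.univ) (s := 0)
    (e := S.half) (q := x) (j := K - 1) S.half_nonneg (by rw [rk_univ]; omega)
    (by rw [rk_univ]; omega)
  rw [rk_univ, ← h3] at h4
  exact ⟨t, h1, h2, .inl (by omega)⟩

/-- A transposition in the center of two elements that are not both always in the center comes
after a time at which one of them enters the center. -/
theorem exists_crosses_pair {K : ℕ} (hK : 2 * K < n) {t u : ℤ} (hu : S.fst t ∉ S.center K u)
    (hf : S.fst t ∈ S.center K t) (hs : S.snd t ∈ S.center K t) :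
    ∃ τ z, 0 ≤ τ ∧ τ < S.half ∧ S.Crosses K τ ∧ z ∈ S.center K (τ + 1) ∧
      z ≠ S.entering K τ ∧ S.pair t = {S.entering K τ, z} := by
  have hh : 0 < S.half := by
    by_contra hcon
    have h0 : S.half = 0 := by have := S.half_nonneg; omega
    have h1 := S.pos_add_half t (S.fst t)
    have h2 := S.pos_add_half t (S.snd t)
    have h3 := S.pos_snd t
    rw [h0, add_zero] at h1 h2
    omega
  -- The center has period `S.half` as a set, so a time outside it can be moved back before `t`.
  obtain ⟨σ, hσt, hσ⟩ : ∃ σ ≤ t, S.fst t ∉ S.center K σ := by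
    refine ⟨u + (-(|u| + |t|)) * S.half, ?_, by rwa [center_add_mul_half]⟩
    have h1 := neg_abs_le t
    have h2 := le_abs_self u
    have h3 := abs_nonneg u
    have h4 := abs_nonneg t
    nlinarith
  obtain ⟨v₀, -, -, hv1, hv2⟩ := exists_step_of_not
    (P := fun v => ¬ (S.fst t ∈ S.center K v ∧ S.snd t ∈ S.center K v)) (s := σ) (e := t)
    hσt (fun h => hσ h.1) (by simp [hf, hs])
  rw [not_not] at hv2
  have key : ∃ z, S.Crosses K v₀ ∧ z ∈ S.center K (v₀ + 1) ∧ z ≠ S.entering K v₀ ∧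
      S.pair t = {S.entering K v₀, z} := by
    by_cases hfv : S.fst t ∈ S.center K v₀
    · have hsv : S.snd t ∉ S.center K v₀ := fun h => hv1 ⟨hfv, h⟩
      obtain ⟨h1, h2⟩ := crosses_of_enters hsv hv2.2
      exact ⟨S.fst t, h1, hv2.1, by rw [← h2]; exact S.fst_ne_snd t, by
        rw [pair, ← h2, Finset.pair_comm]⟩
    · obtain ⟨h1, h2⟩ := crosses_of_enters hfv hv2.1
      exact ⟨S.snd t, h1, hv2.2, by rw [← h2]; exact (S.fst_ne_snd t).symm, by
        rw [pair, ← h2]⟩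
  obtain ⟨z, hz1, hz2, hz3, hz4⟩ := key
  -- Crossing, entering element and center all have period `S.half`, so the crossing can be moved
  -- into the first halfperiod.
  have hper : Function.Periodic (fun v => S.Crosses K v ∧ z ∈ S.center K (v + 1) ∧
      S.entering K v = S.entering K v₀) S.half := by
    intro v
    refine propext ?_
    simp only
    rw [crosses_add_half, add_right_comm, center_add_half]
    refine and_congr_right fun h => ?_
    rw [entering_add_half h hK]
  have hQ := hper.int_mul (-(v₀ / S.half)) v₀
  simp only [Int.cast_id] at hQ
  rw [neg_mul, ← sub_eq_add_neg, mul_comm, ← Int.emod_def] at hQ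
  obtain ⟨h1, h2, h3⟩ := hQ.mpr ⟨hz1, hz2, trivial⟩
  refine ⟨v₀ % S.half, z, Int.emod_nonneg _ hh.ne', Int.emod_lt_of_pos _ hh, h1, h2, ?_, ?_⟩
  · rwa [h3]
  · rwa [h3]

open Classical in
variable (S) in
/-- The elements that never leave the center. -/
noncomputable def permanent (K : ℕ) : Finset (Fin n) :=
  Finset.univ.filter fun x => ∀ t, x ∈ S.center K t

open Classical in
-- Pairs that meet the set `M` of permanent elements number at most `binom(n,2) - binom(n-|M|,2)`.
-- Any other pair transposed in the center is determined by a crossing and a second non-permanent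
-- element `z` of the center just after it, different from the entering one.
theorem card_center_transpositions_le {K : ℕ} (hK : 2 * K < n) :
    ((Finset.Ico 0 S.half).filter fun t => S.fst t ∈ S.center K t ∧ S.snd t ∈ S.center K t).card +
      (n - (S.permanent K).card).choose 2 ≤ n.choose 2 +
      ((Finset.Ico 0 S.half).filter (S.Crosses K)).card *
        (n - 2 * K - (S.permanent K).card - 1) := by
  set M := S.permanent K with hM
  set T := (Finset.Ico 0 S.half).filter fun t => S.fst t ∈ S.center K t ∧ S.snd t ∈ S.center K t
    with hT
  set E := (Finset.Ico 0 S.half).filter (S.Crosses K) with hE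
  have hinj : Set.InjOn S.pair (T : Set ℤ) := by
    refine (S.pair_injOn 0).mono fun t ht => ?_
    rw [zero_add]
    exact Finset.mem_coe.2 (Finset.mem_filter.1 (Finset.mem_coe.1 ht)).1
  have h1 : (T.filter fun t => ¬ S.pair t ⊆ Mᶜ).card + (n - M.card).choose 2 ≤ n.choose 2 := by
    have hsub : (T.filter fun t => ¬ S.pair t ⊆ Mᶜ).image S.pair ∪ Mᶜ.powersetCard 2 ⊆
        (Finset.univ : Finset (Fin n)).powersetCard 2 := by
      apply Finset.union_subset
      · intro e he
        obtain ⟨t, -, rfl⟩ := Finset.mem_image.1 he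
        exact S.pair_mem t
      · exact Finset.powersetCard_mono (Finset.subset_univ _)
    have := Finset.card_le_card hsub
    rw [Finset.card_union_of_disjoint, Finset.card_image_of_injOn] at this
    · simpa [Finset.card_powersetCard, Finset.card_compl] using this
    · exact hinj.mono fun t ht => Finset.mem_coe.2 (Finset.mem_filter.1 (Finset.mem_coe.1 ht)).1
    · rw [Finset.disjoint_left]
      intro e he he'
      obtain ⟨t, ht, rfl⟩ := Finset.mem_image.1 he
      exact (Finset.mem_filter.1 ht).2 (Finset.mem_powersetCard.1 he').1
  have h2 : (T.filter fun t => S.pair t ⊆ Mᶜ).card ≤ E.card * (n - 2 * K - M.card - 1) := by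
    have hcard : (E.sigma fun τ => ((S.center K (τ + 1)) \ M).erase (S.entering K τ)).card =
        E.card * (n - 2 * K - M.card - 1) := by
      rw [Finset.card_sigma]
      refine Finset.sum_const_nat fun τ hτ => ?_
      obtain ⟨h1, h2⟩ := entering_mem (Finset.mem_filter.1 hτ).2 hK
      rw [Finset.card_erase_of_mem, Finset.card_sdiff_of_subset, card_center]
      · intro x hx
        exact (Finset.mem_filter.1 hx).2 _
      · refine Finset.mem_sdiff.2 ⟨h1, fun h => h2 ((Finset.mem_filter.1 h).2 _)⟩
    rw [← hcard]
    have hex : ∀ t ∈ T.filter fun t => S.pair t ⊆ Mᶜ, ∃ p : Σ _ : ℤ, Fin n,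
        p ∈ (E.sigma fun τ => ((S.center K (τ + 1)) \ M).erase (S.entering K τ)) ∧
        S.pair t = {S.entering K p.1, p.2} := by
      intro t ht
      obtain ⟨htT, hpM⟩ := Finset.mem_filter.1 ht
      obtain ⟨-, hf, hs⟩ := Finset.mem_filter.1 htT
      have hfM : S.fst t ∉ M := Finset.mem_compl.1 (hpM (by simp [pair]))
      obtain ⟨u, hu⟩ : ∃ u, S.fst t ∉ S.center K u := by
        simpa [hM, permanent] using hfM
      obtain ⟨τ, z, h1, h2, h3, h4, h5, h6⟩ := exists_crosses_pair hK hu hf hs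
      refine ⟨⟨τ, z⟩, ?_, h6⟩
      have hzM : z ∉ M := Finset.mem_compl.1 (hpM (by rw [h6]; simp))
      simp only [Finset.mem_sigma, Finset.mem_erase, Finset.mem_sdiff, hE, Finset.mem_filter,
        Finset.mem_Ico]
      exact ⟨⟨⟨h1, h2⟩, h3⟩, h5, h4, hzM⟩
    have : Nonempty (Σ _ : ℤ, Fin n) := ⟨⟨0, S.fst 0⟩⟩
    choose! f hf using hex
    refine Finset.card_le_card_of_injOn f (fun t ht => (hf t ht).1) ?_
    intro t ht t' ht' heq
    have e1 := (hf t ht).2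
    rw [heq, ← (hf t' ht').2] at e1
    exact hinj (Finset.mem_coe.2 (Finset.mem_filter.1 (Finset.mem_coe.1 ht)).1)
      (Finset.mem_coe.2 (Finset.mem_filter.1 (Finset.mem_coe.1 ht')).1) e1
  have h3 := Finset.card_filter_add_card_filter_not (s := T) (fun t => S.pair t ⊆ Mᶜ)
  omega

/-- With `K = k + 1`, the crossings are exactly the `k`-edges. With `μ` permanent elements and `d =
n - 2k - 3 - μ`, the center has at most `μ (n - 1) - μ (μ - 1) / 2 + E_k d` transpositions, and the
weights `μ` and `d` add up to `n - 2k - 3`. -/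
theorem choose_two_le (S : AllowableSequence n) {k : ℕ} (hk : 2 * k + 3 ≤ n) :
    n.choose 2 ≤ seqEdgesLE S k + (n - 2 * k - 3) * max (seqEdges S k) (n - 1) := by
  classical
  have hK : 2 * (k + 1) < n := by omega
  have hE : seqEdges S k = ((Finset.Ico 0 S.half).filter (S.Crosses (k + 1))).card := by
    rw [seqEdges_eq]
    congr 1
    apply Finset.filter_congr
    intro t _
    unfold Crosses
    omega
  have hT : seqEdgesLE S k + ((Finset.Ico 0 S.half).filter fun t =>
      S.fst t ∈ S.center (k + 1) t ∧ S.snd t ∈ S.center (k + 1) t).card = n.choose 2 := by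
    have h := Finset.card_filter_add_card_filter_not (s := Finset.Ico 0 S.half)
      (fun t => S.pos t (S.fst t) ≤ k ∨ n ≤ S.pos t (S.fst t) + k + 2)
    rw [← seqEdgesLE_eq k (by omega), Int.card_Ico] at h
    simp only [half, sub_zero, Int.toNat_natCast] at h
    rw [← h]
    congr 2
    apply Finset.filter_congr
    intro t _
    have := S.pos_snd t
    simp only [mem_center]
    omega
  have hmain := card_center_transpositions_le (S := S) hK
  rw [← hE] at hmain
  obtain ⟨τ, hτ1, hτ2, hτ⟩ := exists_crosses (S := S) (K := k + 1) (by omega) hK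
  obtain ⟨hx1, hx2⟩ := entering_mem hτ hK
  -- Some element enters the center, so not all of the center is permanent; hence `d` is not a
  -- truncated difference.
  have hμ : (S.permanent (k + 1)).card + 1 ≤ n - 2 * (k + 1) := by
    rw [← card_center (S := S) (k + 1) (τ + 1), ← Finset.card_insert_of_notMem (a :=
      S.entering (k + 1) τ)]
    · apply Finset.card_le_card
      intro x hx
      rcases Finset.mem_insert.1 hx with rfl | hx
      · exact hx1
      · exact (Finset.mem_filter.1 hx).2 _
    · exact fun h => hx2 ((Finset.mem_filter.1 h).2 _)
  set T := ((Finset.Ico 0 S.half).filter fun t =>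
      S.fst t ∈ S.center (k + 1) t ∧ S.snd t ∈ S.center (k + 1) t).card
  set μ := (S.permanent (k + 1)).card
  set e := seqEdges S k
  obtain ⟨d, hd⟩ : ∃ d, n - 2 * (k + 1) - μ - 1 = d := ⟨_, rfl⟩
  have hn : n = 2 * k + 3 + μ + d := by omega
  have hw : n - 2 * k - 3 = μ + d := by omega
  obtain ⟨m, hm⟩ : ∃ m, n - μ = m := ⟨_, rfl⟩
  rw [hd, hm] at hmain
  rw [hw]
  have c1 : (2 * n.choose 2 : ℤ) = n * (n - 1) := by
    have := Nat.choose_two_right n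
    have h2 : 2 * n.choose 2 = n * (n - 1) := by
      rw [this, Nat.mul_div_cancel' (Nat.even_mul_pred_self n).two_dvd]
    zify [show 1 ≤ n by omega] at h2
    exact h2
  have c2 : (2 * m.choose 2 : ℤ) = (n - μ) * (n - μ - 1) := by
    have := Nat.choose_two_right m
    have h2 : 2 * m.choose 2 = m * (m - 1) := by
      rw [this, Nat.mul_div_cancel' (Nat.even_mul_pred_self m).two_dvd]
    zify [show 1 ≤ m by omega] at h2
    have : (m : ℤ) = n - μ := by omega
    rw [h2, this]
  suffices h : (T : ℤ) ≤ (μ + d) * max (e : ℤ) (n - 1) by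
    have h' : (T : ℤ) ≤ ((μ + d) * max e (n - 1) : ℕ) := by
      push_cast [show 1 ≤ n by omega]
      exact h
    omega
  zify at hmain
  have hx : (e : ℤ) ≤ max (e : ℤ) (n - 1) := le_max_left _ _
  have hy : (n - 1 : ℤ) ≤ max (e : ℤ) (n - 1) := le_max_right _ _
  set X := max (e : ℤ) (n - 1)
  have h4 : (e : ℤ) * d ≤ X * d := mul_le_mul_of_nonneg_right hx (Int.natCast_nonneg d)
  have h5 : (μ : ℤ) * (n - 1) ≤ μ * X := mul_le_mul_of_nonneg_left hy (Int.natCast_nonneg μ)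
  have h6 : (0 : ℤ) ≤ μ * (μ - 1) := by
    rcases Nat.eq_zero_or_pos μ with h | h
    · simp [h]
    · have : (1 : ℤ) ≤ μ := by exact_mod_cast h
      exact mul_nonneg (by omega) (by omega)
  nlinarith

end AllowableSequence
end KEdges

/-! ### Arithmetic of the recursion. -/

namespace KEdges

variable {n : ℕ}

theorem cast_choose_two_eq (a : ℕ) : ((a.choose 2 : ℕ) : ℚ) = a * (a - 1) / 2 :=
  Nat.cast_choose_two ℚ a

/-- The start index as a natural number. -/
theorem exists_startIndex (hn : 3 ≤ n) :
    ∃ m : ℕ, startIndex n = m ∧ 1 ≤ m ∧ n / 3 ≤ m ∧ 4 * n ≤ 9 * m + 11 ∧ 9 * m + 3 ≤ 4 * n := by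
  have h1 : (4 * (n : ℚ) - 11) / 9 ≤ (startIndex n : ℚ) := Int.le_ceil _
  have h2 : (startIndex n : ℚ) < (4 * (n : ℚ) - 11) / 9 + 1 := Int.ceil_lt_add_one _
  have h3 : 4 * (n : ℤ) - 11 ≤ 9 * startIndex n := by
    have : (4 * (n : ℚ) - 11) ≤ 9 * (startIndex n : ℚ) := by linarith
    exact_mod_cast this
  have h4 : 9 * startIndex n < 4 * (n : ℤ) - 2 := by
    have : 9 * (startIndex n : ℚ) < (4 * (n : ℚ) - 2) := by linarith
    exact_mod_cast this
  obtain ⟨m, hm⟩ := Int.eq_ofNat_of_zero_le (a := startIndex n) (by omega)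
  exact ⟨m, hm, by omega, by omega, by omega, by omega⟩

theorem startValue_eq {m : ℕ} (hm : startIndex n = m) (hmn : n / 3 ≤ m) :
    2 * startValue n = ((3 * m * (m + 1) + 3 * (m - (n / 3 : ℕ)) * (m - (n / 3 : ℕ) + 1)
      - 2 * (m - (n / 3 : ℕ)) * (n % 3 : ℕ) : ℤ) : ℚ) := by
  obtain ⟨t, ht⟩ : ∃ t, n / 3 = t := ⟨_, rfl⟩
  obtain ⟨ρ, hρ⟩ : ∃ ρ, n % 3 = ρ := ⟨_, rfl⟩
  obtain ⟨y, rfl⟩ : ∃ y, m = t + y := ⟨m - t, by omega⟩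
  have h1 : (startIndex n + 1).toNat = t + y + 1 := by omega
  have h2 : (startIndex n + 1 - (t : ℤ)).toNat = y + 1 := by omega
  have h3 : (n : ℚ) = 3 * t + ρ := by
    exact_mod_cast (by omega : n = 3 * t + ρ)
  rw [startValue, ht, hρ, h1, h2, hm, cast_choose_two_eq, cast_choose_two_eq, h3]
  push_cast
  ring

/-- Starts the induction of `uFrom_le`. The floor and the ceiling are resolved by fixing `n` modulo
9, which leaves quadratic inequalities in `c = n / 9`. -/
theorem startValue_le (hn : 3 ≤ n) {m : ℕ} (hm : startIndex n = m) :
    startValue n ≤ (n.choose 2 : ℚ) - ((n : ℚ) - 2 * m - 2) * (n - 1) := by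
  obtain ⟨m', hm', h1, h2, h3, h4⟩ := exists_startIndex hn
  obtain rfl : m = m' := by omega
  have hs := startValue_eq hm h2
  rw [cast_choose_two_eq]
  suffices h : ((3 * m * (m + 1) + 3 * (m - (n / 3 : ℕ)) * (m - (n / 3 : ℕ) + 1)
      - 2 * (m - (n / 3 : ℕ)) * (n % 3 : ℕ) : ℤ)) ≤
      n * (n - 1) - 2 * (n - 2 * m - 2) * (n - 1) by
    have h' : ((3 * m * (m + 1) + 3 * (m - (n / 3 : ℕ)) * (m - (n / 3 : ℕ) + 1)
      - 2 * (m - (n / 3 : ℕ)) * (n % 3 : ℕ) : ℤ) : ℚ) ≤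
      ((n * (n - 1) - 2 * (n - 2 * m - 2) * (n - 1) : ℤ) : ℚ) := by exact_mod_cast h
    rw [← hs] at h'
    push_cast at h'
    linarith
  obtain ⟨c, r, hr, hnr⟩ : ∃ c r, r < 9 ∧ n = 9 * c + r :=
    ⟨n / 9, n % 9, Nat.mod_lt _ (by omega), (Nat.div_add_mod n 9).symm⟩
  have hc0 : (0 : ℤ) ≤ c := Int.natCast_nonneg c
  obtain ⟨t, ht⟩ : ∃ t, n / 3 = t := ⟨_, rfl⟩
  obtain ⟨ρ, hρ⟩ : ∃ ρ, n % 3 = ρ := ⟨_, rfl⟩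
  rw [ht, hρ]
  have e1 : (n : ℤ) = 9 * c + r := by exact_mod_cast hnr
  interval_cases r
  · have e2 : (m : ℤ) = 4 * c - 1 := by omega
    have e3 : (t : ℤ) = 3 * c := by omega
    have e4 : (ρ : ℤ) = 0 := by omega
    have hc : (1 : ℤ) ≤ c := by omega
    rw [e1, e2, e3, e4]; nlinarith
  · have e2 : (m : ℤ) = 4 * c := by omega
    have e3 : (t : ℤ) = 3 * c := by omega
    have e4 : (ρ : ℤ) = 1 := by omega
    have hc : (1 : ℤ) ≤ c := by omega
    rw [e1, e2, e3, e4]; nlinarith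
  · have e2 : (m : ℤ) = 4 * c := by omega
    have e3 : (t : ℤ) = 3 * c := by omega
    have e4 : (ρ : ℤ) = 2 := by omega
    have hc : (1 : ℤ) ≤ c := by omega
    rw [e1, e2, e3, e4]; nlinarith
  · have e2 : (m : ℤ) = 4 * c + 1 := by omega
    have e3 : (t : ℤ) = 3 * c + 1 := by omega
    have e4 : (ρ : ℤ) = 0 := by omega
    rw [e1, e2, e3, e4]; nlinarith
  · have e2 : (m : ℤ) = 4 * c + 1 := by omega
    have e3 : (t : ℤ) = 3 * c + 1 := by omega
    have e4 : (ρ : ℤ) = 1 := by omega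
    rw [e1, e2, e3, e4]; nlinarith
  · have e2 : (m : ℤ) = 4 * c + 1 := by omega
    have e3 : (t : ℤ) = 3 * c + 1 := by omega
    have e4 : (ρ : ℤ) = 2 := by omega
    rw [e1, e2, e3, e4]; nlinarith
  · have e2 : (m : ℤ) = 4 * c + 2 := by omega
    have e3 : (t : ℤ) = 3 * c + 2 := by omega
    have e4 : (ρ : ℤ) = 0 := by omega
    rw [e1, e2, e3, e4]; nlinarith
  · have e2 : (m : ℤ) = 4 * c + 2 := by omega
    have e3 : (t : ℤ) = 3 * c + 2 := by omega
    have e4 : (ρ : ℤ) = 1 := by omega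
    rw [e1, e2, e3, e4]; nlinarith
  · have e2 : (m : ℤ) = 4 * c + 3 := by omega
    have e3 : (t : ℤ) = 3 * c + 2 := by omega
    have e4 : (ρ : ℤ) = 2 := by omega
    rw [e1, e2, e3, e4]; nlinarith

/-- The ceiling disappears because `z` is an integer. -/
theorem uFrom_succ_le_iff {m : ℕ} (hm : startIndex n = m) (i : ℕ) (h : 2 * (m + i) + 3 ≤ n)
    (z : ℤ) : uFrom n (i + 1) ≤ (z : ℚ) ↔ (n.choose 2 : ℚ) +
      ((n : ℚ) - 2 * (m + i) - 3) * uFrom n i ≤ ((n : ℚ) - 2 * (m + i) - 2) * z := by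
  have hpos : (0 : ℚ) < (n : ℚ) - 2 * (m + i) - 2 := by
    have : ((2 * (m + i) + 3 : ℕ) : ℚ) ≤ n := by exact_mod_cast h
    push_cast at this
    linarith
  rw [uFrom, hm, Int.cast_le, Int.ceil_le, Int.cast_natCast, one_div, inv_mul_le_iff₀ hpos]

/-- With `w = n - 2(m+i) - 3` and `B = binom(n,2)`, the bound `B - (w+1)(n-1)` is sent by the
recursion to `B - w(n-1)`, an integer, so rounding up does no harm. This is stronger than what the
next index requires. -/
theorem uFrom_le (hn : 3 ≤ n) {m : ℕ} (hm : startIndex n = m) (i : ℕ)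
    (h : 2 * (m + i) + 1 ≤ n) :
    uFrom n i ≤ (n.choose 2 : ℚ) - ((n : ℚ) - 2 * (m + i) - 2) * (n - 1) := by
  have hn1 : (1 : ℚ) ≤ n := by exact_mod_cast (by omega : 1 ≤ n)
  induction i with
  | zero => simpa [uFrom] using startValue_le hn hm
  | succ i ih =>
    have ih := ih (by omega)
    have h3 : ((2 * (m + i) + 3 : ℕ) : ℚ) ≤ n := by exact_mod_cast (by omega)
    push_cast at h3
    have key := (uFrom_succ_le_iff hm i (by omega)
      ((n.choose 2 : ℤ) - ((n : ℤ) - 2 * (m + i) - 3) * (n - 1))).2 (by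
        push_cast
        have := mul_le_mul_of_nonneg_left ih
          (by linarith : (0 : ℚ) ≤ (n : ℚ) - 2 * (m + i) - 3)
        linarith)
    push_cast at key ⊢
    nlinarith

/-- The stronger bound after at least one step of the recursion. -/
theorem uFrom_succ_le (hn : 3 ≤ n) {m : ℕ} (hm : startIndex n = m) (i : ℕ)
    (h : 2 * (m + i) + 3 ≤ n) :
    uFrom n (i + 1) ≤ (n.choose 2 : ℚ) - ((n : ℚ) - 2 * (m + i) - 3) * (n - 1) := by
  have ih := uFrom_le hn hm i (by omega)
  have h3 : ((2 * (m + i) + 3 : ℕ) : ℚ) ≤ n := by exact_mod_cast h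
  push_cast at h3
  have key := (uFrom_succ_le_iff hm i h
    ((n.choose 2 : ℤ) - ((n : ℤ) - 2 * (m + i) - 3) * (n - 1))).2 (by
      push_cast
      have := mul_le_mul_of_nonneg_left ih
        (by linarith : (0 : ℚ) ≤ (n : ℚ) - 2 * (m + i) - 3)
      linarith)
  push_cast at key
  exact key

/-- The case distinction is whether `E_k` reaches `n - 1`, for `k = m + i`: if it does, the
recursion carries the bound over; if not, `uFrom_succ_le` gives it without the induction hypothesis.
-/
theorem uFrom_le_seqEdgesLE (S : AllowableSequence n) (hn : 3 ≤ n) {m : ℕ}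
    (hm : startIndex n = m) (hm1 : 1 ≤ m) (i : ℕ) (h : 2 * (m + i) + 1 ≤ n) :
    uFrom n i ≤ (seqEdgesLE S (m + i - 1) : ℚ) := by
  induction i with
  | zero =>
    obtain ⟨m', hm', -, h2, -, -⟩ := exists_startIndex hn
    obtain rfl : m = m' := by omega
    have hb := (AllowableSequence.card_low_lower_bound (S := S) m Finset.univ
      (by simpa using h)).2 (by simpa using h2)
    have hl := AllowableSequence.card_low_univ (S := S) (m - 1) (by omega)
    rw [Nat.sub_add_cancel hm1] at hl
    rw [hl, Finset.card_univ, Fintype.card_fin] at hb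
    have hs := startValue_eq hm h2
    have hb' : 2 * startValue n ≤ ((2 * seqEdgesLE S (m - 1) : ℤ) : ℚ) := by
      rw [hs]
      exact_mod_cast hb
    push_cast at hb'
    rw [uFrom, add_zero]
    linarith
  | succ i ih =>
    have ih := ih (by omega)
    have hk : 2 * (m + i) + 3 ≤ n := by omega
    have hsum : seqEdgesLE S (m + i) = seqEdgesLE S (m + i - 1) + seqEdges S (m + i) := by
      rw [seqEdgesLE, Finset.sum_range_succ, seqEdgesLE, Nat.sub_add_cancel (by omega)]
    have hmain := AllowableSequence.choose_two_le S hk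
    rw [show m + (i + 1) - 1 = m + i by omega]
    obtain ⟨d, hd⟩ : ∃ d, n = 2 * (m + i) + 3 + d := ⟨n - (2 * (m + i) + 3), by omega⟩
    have hd' : n - 2 * (m + i) - 3 = d := by omega
    have hdq : (d : ℚ) = (n : ℚ) - 2 * (m + i) - 3 := by rw [hd]; push_cast; ring
    rw [hd'] at hmain
    rcases le_total (n - 1) (seqEdges S (m + i)) with hle | hle
    · rw [max_eq_left hle] at hmain
      have hq : (n.choose 2 : ℚ) ≤ seqEdgesLE S (m + i) + d * seqEdges S (m + i) := by
        exact_mod_cast hmain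
      have hsq : (seqEdgesLE S (m + i) : ℚ) =
          seqEdgesLE S (m + i - 1) + seqEdges S (m + i) := by exact_mod_cast hsum
      have := (uFrom_succ_le_iff hm i hk (seqEdgesLE S (m + i))).2 (by
        rw [← hdq, show (n : ℚ) - 2 * (m + i) - 2 = d + 1 by rw [hdq]; ring]
        have := mul_le_mul_of_nonneg_left ih (Nat.cast_nonneg (α := ℚ) d)
        push_cast
        nlinarith)
      exact_mod_cast this
    · rw [max_eq_right hle] at hmain
      have hq : (n.choose 2 : ℚ) ≤ seqEdgesLE S (m + i) + d * (n - 1) := by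
        have : (n.choose 2 : ℚ) ≤ seqEdgesLE S (m + i) + d * ((n - 1 : ℕ) : ℚ) := by
          exact_mod_cast hmain
        rwa [Nat.cast_sub (by omega), Nat.cast_one] at this
      have := uFrom_succ_le hn hm i hk
      rw [← hdq] at this
      linarith

theorem u_le_seqEdgesLE (S : AllowableSequence n) {k : ℕ} (hmk : startIndex n - 1 ≤ (k : ℤ))
    (hk : 2 * k + 3 ≤ n) : u n k ≤ (seqEdgesLE S k : ℚ) := by
  obtain ⟨m, hm, hm1, -⟩ := exists_startIndex (n := n) (by omega)
  obtain ⟨i, hi⟩ : ∃ i, k + 1 = m + i := ⟨k + 1 - m, by omega⟩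
  have h := uFrom_le_seqEdgesLE S (by omega) hm hm1 i (by omega)
  rw [u, show (k - (startIndex n - 1) : ℤ).toNat = i by omega]
  rwa [show m + i - 1 = k by omega] at h

end KEdges

/-! ### Allowable sequences from orderings of the pairs. -/

namespace KEdges

/-- A finite set can be enumerated according to the values of a real function. -/
theorem exists_sorting {α : Type*} (Q : Finset α) (s : α → ℝ) :
    ∃ T : α → ℕ, (∀ x ∈ Q, T x < Q.card) ∧ Set.InjOn T Q ∧
      ∀ x ∈ Q, ∀ y ∈ Q, s x < s y → T x < T y := by
  classical
  let g : Fin Q.card → ℝ := fun i => s (Q.equivFin.symm i)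
  let σ := Tuple.sort g
  have hσ : Monotone (g ∘ σ) := Tuple.monotone_sort g
  let r : Q → Fin Q.card := fun x => σ.symm (Q.equivFin x)
  have hr : Function.Injective r := σ.symm.injective.comp Q.equivFin.injective
  have hs : ∀ x, g (σ (r x)) = s x := by intro x; simp [g, r]
  refine ⟨fun x => if h : x ∈ Q then (r ⟨x, h⟩ : ℕ) else 0, ?_, ?_, ?_⟩
  · intro x hx
    simp only [hx, dif_pos]
    exact (r ⟨x, hx⟩).isLt
  · intro x hx y hy h
    have hx' : x ∈ Q := hx
    have hy' : y ∈ Q := hy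
    simp only [hx', hy', dif_pos] at h
    simpa using hr (Fin.ext h)
  · intro x hx y hy hlt
    simp only [hx, hy, dif_pos]
    by_contra hcon
    have hle : r ⟨y, hy⟩ ≤ r ⟨x, hx⟩ := by
      rw [Fin.le_def]; omega
    have := hσ hle
    simp only [Function.comp_apply, hs] at this
    linarith

/-! ### The sequence of an enumeration of the pairs -/

variable {n : ℕ}

/-- The order of the elements after the first `t` transpositions, where the pair `e` is transposed
in step `T e`. -/
def Before (T : Finset (Fin n) → ℕ) (t : ℕ) (i j : Fin n) : Prop :=
  (i < j ∧ t ≤ T {i, j}) ∨ (j < i ∧ T {i, j} < t)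

/-- An enumeration of the pairs in which every triple is traversed in lexicographic or in reverse
lexicographic order. -/
structure IsSweep (T : Finset (Fin n) → ℕ) : Prop where
  lt : ∀ e ∈ (Finset.univ : Finset (Fin n)).powersetCard 2, T e < n.choose 2
  injOn : Set.InjOn T ((Finset.univ : Finset (Fin n)).powersetCard 2)
  triple : ∀ i j k : Fin n, i < j → j < k →
    (T {i, j} < T {i, k} ∧ T {i, k} < T {j, k}) ∨ (T {j, k} < T {i, k} ∧ T {i, k} < T {i, j})

theorem pair_mem_powersetCard {i j : Fin n} (h : i ≠ j) :
    {i, j} ∈ (Finset.univ : Finset (Fin n)).powersetCard 2 := by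
  simp [Finset.mem_powersetCard, Finset.card_pair h]

section Sweep

variable {T : Finset (Fin n) → ℕ}

theorem Before.asymm {t : ℕ} {i j : Fin n} (h : Before T t i j) : ¬ Before T t j i := by
  unfold Before at *
  rw [Finset.pair_comm j i]
  omega

theorem before_or {t : ℕ} {i j : Fin n} (h : i ≠ j) : Before T t i j ∨ Before T t j i := by
  unfold Before
  rw [Finset.pair_comm j i]
  omega

theorem Before.ne {t : ℕ} {i j : Fin n} (h : Before T t i j) : i ≠ j := by
  rintro rfl
  exact h.asymm h

/-- A cyclic order of three elements would require the middle one of the three times in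
`IsSweep.triple` to lie outside the other two. -/
theorem Before.trans (hT : IsSweep T) {t : ℕ} {i j k : Fin n} (h : Before T t i j)
    (h' : Before T t j k) : Before T t i k := by
  have hik : i ≠ k := by rintro rfl; exact h.asymm h'
  have hij := h.ne
  have hjk := h'.ne
  have e1 := Finset.pair_comm i j
  have e2 := Finset.pair_comm i k
  have e3 := Finset.pair_comm j k
  have t1 := hT.triple i j k
  have t2 := hT.triple i k j
  have t3 := hT.triple j i k
  have t4 := hT.triple j k i
  have t5 := hT.triple k i j
  have t6 := hT.triple k j i
  unfold Before at *
  rw [← e1] at t3 t4 t6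
  rw [← e2] at t4 t5 t6
  rw [← e3] at t2 t5 t6
  omega

open Classical in
/-- The (0-based) position of `i` after `t` transpositions. -/
noncomputable def sweepPos (T : Finset (Fin n) → ℕ) (t : ℕ) (i : Fin n) : ℕ :=
  (Finset.univ.filter fun j => Before T t j i).card

theorem sweepPos_lt_sweepPos (hT : IsSweep T) {t : ℕ} {i j : Fin n} (h : Before T t i j) :
    sweepPos T t i < sweepPos T t j := by
  classical
  apply Finset.card_lt_card
  rw [Finset.ssubset_iff_of_subset]
  · exact ⟨i, by simpa using h, by simpa using fun h' : Before T t i i => h'.ne rfl⟩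
  · intro z hz
    simp only [Finset.mem_filter, Finset.mem_univ, true_and] at hz ⊢
    exact hz.trans hT h

theorem sweepPos_lt (T : Finset (Fin n) → ℕ) (t : ℕ) (i : Fin n) : sweepPos T t i < n := by
  classical
  have h : (Finset.univ.filter fun j => Before T t j i) ⊂ Finset.univ := by
    rw [Finset.ssubset_iff_of_subset (Finset.subset_univ _)]
    exact ⟨i, Finset.mem_univ _, by simpa using fun h' : Before T t i i => h'.ne rfl⟩
  simpa [sweepPos] using Finset.card_lt_card h

theorem sweepPos_injective (hT : IsSweep T) (t : ℕ) : Function.Injective (sweepPos T t) := by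
  intro i j h
  by_contra hne
  rcases before_or (T := T) (t := t) hne with h' | h' <;>
  · have := sweepPos_lt_sweepPos hT h'
    omega

/-- The permutation after `t` transpositions. -/
noncomputable def sweepPerm (hT : IsSweep T) (t : ℕ) : Equiv.Perm (Fin n) :=
  (Equiv.ofBijective (fun i => (⟨sweepPos T t i, sweepPos_lt T t i⟩ : Fin n))
    (Finite.injective_iff_bijective.1 fun _ _ h =>
      sweepPos_injective hT t (Fin.ext_iff.1 h))).symm

theorem sweepPerm_symm (hT : IsSweep T) (t : ℕ) (i : Fin n) :
    ((sweepPerm hT t).symm i : ℕ) = sweepPos T t i := rfl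

theorem IsSweep.exists_pair (hT : IsSweep T) {t : ℕ} (ht : t < n.choose 2) :
    ∃ i j : Fin n, i < j ∧ T {i, j} = t := by
  have h : ((Finset.univ : Finset (Fin n)).powersetCard 2).image T = Finset.range (n.choose 2) := by
    apply Finset.eq_of_subset_of_card_le
    · intro s hs
      obtain ⟨e, he, rfl⟩ := Finset.mem_image.1 hs
      exact Finset.mem_range.2 (hT.lt e he)
    · rw [Finset.card_image_of_injOn hT.injOn]
      simp [Finset.card_powersetCard]
  obtain ⟨e, he, rfl⟩ := Finset.mem_image.1 (h ▸ Finset.mem_range.2 ht)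
  obtain ⟨i, j, hij, rfl⟩ := Finset.card_eq_two.1 (Finset.mem_powersetCard.1 he).2
  rcases lt_or_gt_of_ne hij with h | h
  · exact ⟨i, j, h, rfl⟩
  · exact ⟨j, i, h, by rw [Finset.pair_comm]⟩

theorem before_succ_iff (hT : IsSweep T) {i j a b : Fin n} (hij : i < j)
    (h : ¬ (a = i ∧ b = j)) (h' : ¬ (a = j ∧ b = i)) :
    Before T (T {i, j} + 1) a b ↔ Before T (T {i, j}) a b := by
  by_cases hab : a = b
  · subst hab
    exact ⟨fun h => absurd rfl h.ne, fun h => absurd rfl h.ne⟩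
  have hne : T {a, b} ≠ T {i, j} := by
    intro he
    have := hT.injOn (pair_mem_powersetCard hab) (pair_mem_powersetCard hij.ne) he
    rw [← Finset.coe_inj, Finset.coe_pair, Finset.coe_pair, Set.pair_eq_pair_iff] at this
    tauto
  unfold Before
  omega

theorem before_pair {i j : Fin n} (hij : i < j) : Before T (T {i, j}) i j :=
  .inl ⟨hij, le_rfl⟩

theorem before_succ_pair {i j : Fin n} (hij : i < j) : Before T (T {i, j} + 1) j i :=
  .inr ⟨hij, by rw [Finset.pair_comm]; omega⟩

theorem sweepPos_succ (hT : IsSweep T) {i j : Fin n} (hij : i < j) :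
    sweepPos T (T {i, j}) j = sweepPos T (T {i, j}) i + 1 ∧
    sweepPos T (T {i, j} + 1) i = sweepPos T (T {i, j}) i + 1 ∧
    sweepPos T (T {i, j} + 1) j = sweepPos T (T {i, j}) i ∧
    ∀ z, z ≠ i → z ≠ j → sweepPos T (T {i, j} + 1) z = sweepPos T (T {i, j}) z := by
  classical
  have h1 : sweepPos T (T {i, j} + 1) i = sweepPos T (T {i, j}) i + 1 := by
    have : (Finset.univ.filter fun z => Before T (T {i, j} + 1) z i) =
        insert j (Finset.univ.filter fun z => Before T (T {i, j}) z i) := by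
      ext z
      simp only [Finset.mem_filter, Finset.mem_univ, true_and, Finset.mem_insert]
      by_cases hz : z = j
      · subst hz; simp [before_succ_pair hij]
      · rw [before_succ_iff hT hij (by rintro ⟨-, h⟩; exact hij.ne h) (by tauto)]
        simp [hz]
    rw [sweepPos, this, Finset.card_insert_of_notMem, sweepPos]
    simpa using (before_pair hij).asymm
  have h2 : sweepPos T (T {i, j}) j = sweepPos T (T {i, j} + 1) j + 1 := by
    have : (Finset.univ.filter fun z => Before T (T {i, j}) z j) =
        insert i (Finset.univ.filter fun z => Before T (T {i, j} + 1) z j) := by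
      ext z
      simp only [Finset.mem_filter, Finset.mem_univ, true_and, Finset.mem_insert]
      by_cases hz : z = i
      · subst hz; simp [before_pair hij]
      · rw [before_succ_iff hT hij (by tauto) (by rintro ⟨-, h⟩; exact hij.ne h.symm)]
        simp [hz]
    rw [sweepPos, this, Finset.card_insert_of_notMem, sweepPos]
    simpa using (before_succ_pair hij).asymm
  have h3 := sweepPos_lt_sweepPos hT (before_pair (T := T) hij)
  have h4 := sweepPos_lt_sweepPos hT (before_succ_pair (T := T) hij)
  refine ⟨by omega, h1, by omega, fun z hzi hzj => ?_⟩
  unfold sweepPos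
  congr 1
  apply Finset.filter_congr
  intro a _
  exact before_succ_iff hT hij (by tauto) (by tauto)

theorem sweepPerm_succ (hT : IsSweep T) {t : ℕ} (ht : t < n.choose 2) :
    ∃ i, IsTranspositionAt (sweepPerm hT t) (sweepPerm hT (t + 1)) i := by
  obtain ⟨i, j, hij, rfl⟩ := hT.exists_pair ht
  obtain ⟨h1, h2, h3, h4⟩ := sweepPos_succ hT hij
  have hsymm : ∀ z, (sweepPerm hT (T {i, j} + 1)).symm z =
      Equiv.swap ((sweepPerm hT (T {i, j})).symm i) ((sweepPerm hT (T {i, j})).symm j)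
        ((sweepPerm hT (T {i, j})).symm z) := by
    intro z
    by_cases hzi : z = i
    · subst hzi
      rw [Equiv.swap_apply_left, Fin.ext_iff, sweepPerm_symm, sweepPerm_symm, h1, h2]
    by_cases hzj : z = j
    · subst hzj
      rw [Equiv.swap_apply_right, Fin.ext_iff, sweepPerm_symm, sweepPerm_symm, h3]
    · rw [Equiv.swap_apply_of_ne_of_ne, Fin.ext_iff, sweepPerm_symm, sweepPerm_symm, h4 z hzi hzj]
      · simpa using hzi
      · simpa using hzj
  refine ⟨sweepPos T (T {i, j}) j, (sweepPerm hT (T {i, j})).symm i,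
    (sweepPerm hT (T {i, j})).symm j, ?_, rfl, ?_⟩
  · rw [sweepPerm_symm, h1]
  -- The swap was found on positions, that is for the inverse permutations; it is carried over to
  -- the permutations themselves.
  · ext p
    have := hsymm (sweepPerm hT (T {i, j} + 1) p)
    rw [Equiv.symm_apply_apply] at this
    rw [Equiv.Perm.mul_apply]
    nth_rewrite 2 [this]
    rw [Equiv.swap_apply_self, Equiv.apply_symm_apply]

theorem before_choose_two (hT : IsSweep T) (i j : Fin n) :
    Before T (n.choose 2) i j ↔ Before T 0 j i := by
  unfold Before
  by_cases hij : i = j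
  · simp [hij]
  have := hT.lt _ (pair_mem_powersetCard hij)
  rw [Finset.pair_comm j i]
  omega

theorem sweepPos_choose_two (hT : IsSweep T) (i : Fin n) :
    sweepPos T (n.choose 2) i + sweepPos T 0 i + 1 = n := by
  classical
  have h : (Finset.univ : Finset (Fin n)) = insert i ((Finset.univ.filter fun z =>
      Before T (n.choose 2) z i) ∪ (Finset.univ.filter fun z => Before T 0 z i)) := by
    ext z
    simp only [Finset.mem_univ, Finset.mem_insert, Finset.mem_union, Finset.mem_filter, true_and,
      true_iff, before_choose_two hT]
    by_cases hz : z = i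
    · exact .inl hz
    · exact .inr (before_or (Ne.symm hz))
  have h' := congrArg Finset.card h
  rw [Finset.card_insert_of_notMem, Finset.card_union_of_disjoint] at h'
  · simp only [Finset.card_univ, Fintype.card_fin] at h'
    exact h'.symm
  · rw [Finset.disjoint_filter]
    intro z _ hz
    exact ((before_choose_two hT _ _).1 hz).asymm
  · simp only [Finset.mem_union, Finset.mem_filter, Finset.mem_univ, true_and]
    rintro (h | h) <;> exact h.ne rfl

theorem sweepPerm_choose_two (hT : IsSweep T) :
    sweepPerm hT (n.choose 2) = sweepPerm hT 0 * Fin.revPerm := by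
  have hsymm : ∀ z, (sweepPerm hT (n.choose 2)).symm z = Fin.rev ((sweepPerm hT 0).symm z) := by
    intro z
    have h := sweepPos_choose_two hT z
    rw [Fin.ext_iff, Fin.val_rev, sweepPerm_symm, sweepPerm_symm]
    omega
  ext p
  have h := hsymm (sweepPerm hT (n.choose 2) p)
  rw [Equiv.symm_apply_apply] at h
  rw [Equiv.Perm.mul_apply, Fin.revPerm_apply]
  nth_rewrite 2 [h]
  rw [Fin.rev_rev, Equiv.apply_symm_apply]

theorem IsTranspositionAt.mul_revPerm {σ ρ : Equiv.Perm (Fin n)} {i : ℕ}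
    (h : IsTranspositionAt σ ρ i) :
    IsTranspositionAt (σ * Fin.revPerm) (ρ * Fin.revPerm) (n - i) := by
  obtain ⟨a, b, ha, hb, rfl⟩ := h
  have hbn := b.isLt
  refine ⟨Fin.rev b, Fin.rev a, ?_, ?_, ?_⟩
  · rw [Fin.val_rev]; omega
  · rw [Fin.val_rev]; omega
  · ext p
    simp only [Equiv.Perm.mul_apply, Fin.revPerm_apply, Equiv.swap_apply_def]
    have hab : a ≠ b := by rintro rfl; omega
    grind [Fin.rev_rev]

/-- The permutations of a sweep, continued periodically. -/
noncomputable def sweepSeq (hT : IsSweep T) (z : ℤ) : Equiv.Perm (Fin n) :=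
  if Even (z / (n.choose 2 : ℕ)) then sweepPerm hT (z % (n.choose 2 : ℕ)).toNat
  else sweepPerm hT (z % (n.choose 2 : ℕ)).toNat * Fin.revPerm

theorem revPerm_mul_revPerm : (Fin.revPerm : Equiv.Perm (Fin n)) * Fin.revPerm = 1 := by
  ext p; simp

theorem sweepSeq_add (hT : IsSweep T) (h0 : 0 < n.choose 2) (z : ℤ) :
    sweepSeq hT (z + (n.choose 2 : ℕ)) = sweepSeq hT z * Fin.revPerm := by
  unfold sweepSeq
  rw [Int.add_emod_right, Int.add_ediv_of_dvd_right dvd_rfl, Int.ediv_self (by omega)]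
  by_cases h : Even (z / (n.choose 2 : ℕ))
  · simp [h]
  · simp [h, mul_assoc, revPerm_mul_revPerm]

theorem sweepSeq_natCast (hT : IsSweep T) (h0 : 0 < n.choose 2) {t : ℕ} (ht : t ≤ n.choose 2) :
    sweepSeq hT t = sweepPerm hT t := by
  rcases ht.lt_or_eq with h | rfl
  · unfold sweepSeq
    rw [Int.emod_eq_of_lt (by omega) (by omega), Int.ediv_eq_zero_of_lt (by omega) (by omega)]
    simp
  · have h := sweepSeq_add hT h0 0
    rw [zero_add] at h
    rw [h, sweepPerm_choose_two]
    simp [sweepSeq]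

theorem sweepSeq_step (hT : IsSweep T) (h0 : 0 < n.choose 2) (z : ℤ) :
    ∃ i, IsTranspositionAt (sweepSeq hT z) (sweepSeq hT (z + 1)) i := by
  have key : ∀ z : ℤ, (∃ i, IsTranspositionAt (sweepSeq hT z) (sweepSeq hT (z + 1)) i) →
      ∃ i, IsTranspositionAt (sweepSeq hT (z + (n.choose 2 : ℕ)))
        (sweepSeq hT (z + (n.choose 2 : ℕ) + 1)) i := by
    rintro z ⟨i, hi⟩
    rw [add_right_comm, sweepSeq_add hT h0, sweepSeq_add hT h0]
    exact ⟨_, hi.mul_revPerm⟩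
  have key' : ∀ z : ℤ, (∃ i, IsTranspositionAt (sweepSeq hT z) (sweepSeq hT (z + 1)) i) →
      ∃ i, IsTranspositionAt (sweepSeq hT (z - (n.choose 2 : ℕ)))
        (sweepSeq hT (z - (n.choose 2 : ℕ) + 1)) i := by
    rintro z ⟨i, hi⟩
    have h1 := sweepSeq_add hT h0 (z - (n.choose 2 : ℕ))
    have h2 := sweepSeq_add hT h0 (z - (n.choose 2 : ℕ) + 1)
    rw [sub_add_cancel] at h1
    rw [sub_add_eq_add_sub, sub_add_cancel] at h2
    rw [h1, h2] at hi
    have := hi.mul_revPerm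
    rw [mul_assoc, mul_assoc, revPerm_mul_revPerm, mul_one, mul_one] at this
    rw [sub_add_eq_add_sub]
    exact ⟨_, this⟩
  have base : ∀ r : ℕ, r < n.choose 2 →
      ∃ i, IsTranspositionAt (sweepSeq hT r) (sweepSeq hT (r + 1)) i := by
    intro r hr
    have h := sweepPerm_succ hT hr
    rwa [← sweepSeq_natCast hT h0 hr.le, ← sweepSeq_natCast hT h0 hr, Nat.cast_succ] at h
  obtain ⟨r, hr⟩ := Int.eq_ofNat_of_zero_le (Int.emod_nonneg z (b := (n.choose 2 : ℕ)) (by omega))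
  have hrlt := Int.emod_lt_of_pos z (b := (n.choose 2 : ℕ)) (by omega)
  have hz := Int.emod_add_mul_ediv z (n.choose 2 : ℕ)
  rw [hr] at hz hrlt
  have hbase := base r (by omega)
  rw [← hz]
  induction z / (n.choose 2 : ℕ) using Int.induction_on with
  | zero => simpa using hbase
  | succ i ih =>
    have := key _ ih
    rwa [add_assoc, ← mul_add_one] at this
  | pred i ih =>
    have := key' _ ih
    rwa [add_sub_assoc, ← mul_sub_one] at this

/-- The allowable sequence of a sweep. -/
noncomputable def IsSweep.sequence (hT : IsSweep T) (h0 : 0 < n.choose 2) :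
    AllowableSequence n where
  perm := sweepSeq hT
  step := sweepSeq_step hT h0
  reverse j p := by rw [sweepSeq_add hT h0]; rfl

theorem IsSweep.pos_sequence (hT : IsSweep T) (h0 : 0 < n.choose 2) {t : ℕ}
    (ht : t ≤ n.choose 2) (i : Fin n) : (hT.sequence h0).pos t i = sweepPos T t i := by
  rw [AllowableSequence.pos, IsSweep.sequence]
  simp only [sweepSeq_natCast hT h0 ht, sweepPerm_symm]

theorem IsSweep.fst_snd_sequence (hT : IsSweep T) (h0 : 0 < n.choose 2) {i j : Fin n}
    (hij : i < j) : (hT.sequence h0).fst (T {i, j} : ℕ) = i ∧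
      (hT.sequence h0).snd (T {i, j} : ℕ) = j := by
  have hlt := hT.lt _ (pair_mem_powersetCard hij.ne)
  obtain ⟨h1, h2, h3, -⟩ := sweepPos_succ hT hij
  apply (hT.sequence h0).fst_snd_of_lt_of_not_lt
  · rw [hT.pos_sequence h0 hlt.le, hT.pos_sequence h0 hlt.le]; omega
  · rw [← Nat.cast_succ, hT.pos_sequence h0 hlt, hT.pos_sequence h0 hlt, Nat.succ_eq_add_one]
    omega

end Sweep

end KEdges

/-! ### From point sets to allowable sequences. -/

namespace KEdges

variable {n : ℕ}

/-- Twice the signed area of the triangle `p q r`. -/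
def det (p q r : Plane) : ℝ := (q 0 - p 0) * (r 1 - p 1) - (q 1 - p 1) * (r 0 - p 0)

theorem isLeft_iff {p q r : Plane} : IsLeft p q r ↔ 0 < det p q r := Iff.rfl

theorem det_swap_left (p q r : Plane) : det q p r = -det p q r := by unfold det; ring

theorem det_rotate (p q r : Plane) : det q r p = det p q r := by unfold det; ring

theorem collinear_of_det_eq_zero {p q r : Plane} (hpq : p ≠ q) (h : det p q r = 0) :
    Collinear ℝ {p, q, r} := by
  rw [collinear_iff_of_mem (p₀ := p) (by simp)]
  refine ⟨q - p, fun s hs => ?_⟩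
  have hrs : ∃ t : ℝ, r = t • (q - p) + p := by
    unfold det at h
    by_cases h0 : q 0 - p 0 = 0
    · have h1 : q 1 - p 1 ≠ 0 := by
        intro h1
        apply hpq
        ext i
        fin_cases i <;> simp <;> linarith
      refine ⟨(r 1 - p 1) / (q 1 - p 1), ?_⟩
      have h2 : r 0 - p 0 = 0 := by
        rw [h0, zero_mul, zero_sub, neg_eq_zero] at h
        exact (mul_eq_zero.1 h).resolve_left h1
      ext i
      fin_cases i
      · simp only [Fin.zero_eta, PiLp.add_apply, PiLp.smul_apply, PiLp.sub_apply, smul_eq_mul]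
        rw [h0]; linarith
      · simp only [Fin.mk_one, PiLp.add_apply, PiLp.smul_apply, PiLp.sub_apply, smul_eq_mul]
        field_simp
        ring
    · refine ⟨(r 0 - p 0) / (q 0 - p 0), ?_⟩
      ext i
      fin_cases i
      · simp only [Fin.zero_eta, PiLp.add_apply, PiLp.smul_apply, PiLp.sub_apply, smul_eq_mul]
        field_simp
        ring
      · simp only [Fin.mk_one, PiLp.add_apply, PiLp.smul_apply, PiLp.sub_apply, smul_eq_mul]
        field_simp
        linarith
  simp only [Set.mem_insert_iff, Set.mem_singleton_iff] at hs
  simp only [vadd_eq_add]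
  rcases hs with rfl | rfl | rfl
  · exact ⟨0, by simp⟩
  · exact ⟨1, by simp⟩
  · exact hrs

theorem det_eq_zero_of_collinear {p q r : Plane} (h : Collinear ℝ {p, q, r}) :
    det p q r = 0 := by
  rw [collinear_iff_of_mem (p₀ := p) (by simp)] at h
  obtain ⟨v, hv⟩ := h
  obtain ⟨a, ha⟩ := hv q (by simp)
  obtain ⟨b, hb⟩ := hv r (by simp)
  simp only [det, ha, hb, vadd_eq_add, PiLp.add_apply, PiLp.smul_apply, smul_eq_mul]
  ring

/-- Some linear functional takes different values at the points of `P`. -/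
theorem exists_shear (P : Finset Plane) :
    ∃ c : ℝ, Set.InjOn (fun p : Plane => p 0 + c * p 1) P := by
  have hfin : (⋃ p ∈ P, ⋃ q ∈ P, {c : ℝ | p ≠ q ∧ p 0 + c * p 1 = q 0 + c * q 1}).Finite := by
    refine Set.Finite.biUnion P.finite_toSet fun p _ =>
      Set.Finite.biUnion P.finite_toSet fun q _ => Set.Subsingleton.finite ?_
    rintro c ⟨hne, hc⟩ d ⟨-, hd⟩
    by_contra hcd
    have h1 : (c - d) * (p 1 - q 1) = 0 := by linarith
    have h2 : p 1 - q 1 = 0 := (mul_eq_zero.1 h1).resolve_left (sub_ne_zero.2 hcd)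
    have h3 : p 1 = q 1 := by linarith
    apply hne
    ext i
    fin_cases i
    · simp only [Fin.zero_eta]
      rw [h3] at hc
      linarith
    · exact h3
  obtain ⟨c, hc⟩ := hfin.infinite_compl.nonempty
  refine ⟨c, fun p hp q hq h => ?_⟩
  by_contra hne
  exact hc (Set.mem_biUnion hp (Set.mem_biUnion hq ⟨hne, h⟩))

/-- The points of `P` can be labelled in increasing order of a given functional. -/
theorem exists_labelling {P : Finset Plane} (hP : P.card = n) {X : Plane → ℝ}
    (hX : Set.InjOn X P) :
    ∃ f : Fin n → Plane, Finset.univ.image f = P ∧ StrictMono (X ∘ f) := by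
  classical
  have hcard : (P.image X).card = n := by rw [Finset.card_image_of_injOn hX, hP]
  let g := (P.image X).orderEmbOfFin hcard
  have hg : ∀ i, ∃ p ∈ P, X p = g i := fun i =>
    Finset.mem_image.1 ((P.image X).orderEmbOfFin_mem hcard i)
  choose f hfP hfX using hg
  have hmono : StrictMono (X ∘ f) := by
    intro i j hij
    simp only [Function.comp_apply, hfX]
    exact g.strictMono hij
  refine ⟨f, ?_, hmono⟩
  apply Finset.eq_of_subset_of_card_le
  · intro p hp
    obtain ⟨i, -, rfl⟩ := Finset.mem_image.1 hp
    exact hfP i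
  · rw [Finset.card_image_of_injective _ hmono.injective.of_comp, hP]
    simp

/-- A labelling `f` of `P` from left to right, and an enumeration `T` of the pairs of labels by
increasing slope. -/
theorem exists_sweep {P : Finset Plane} (hP : P.card = n) (hgen : GeneralPosition P) :
    ∃ (f : Fin n → Plane) (T : Finset (Fin n) → ℕ), Finset.univ.image f = P ∧
      Function.Injective f ∧
      (∀ i j k, i ≠ j → i ≠ k → j ≠ k → det (f i) (f j) (f k) ≠ 0) ∧
      (∀ e ∈ (Finset.univ : Finset (Fin n)).powersetCard 2, T e < n.choose 2) ∧
      Set.InjOn T ((Finset.univ : Finset (Fin n)).powersetCard 2) ∧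
      ∀ i j k, i < j → j < k →
        (0 < det (f i) (f j) (f k) → T {i, j} < T {i, k} ∧ T {i, k} < T {j, k}) ∧
        (det (f i) (f j) (f k) < 0 → T {j, k} < T {i, k} ∧ T {i, k} < T {i, j}) := by
  obtain ⟨c, hc⟩ := exists_shear P
  obtain ⟨f, hf, hmono⟩ := exists_labelling hP hc
  have hinj : Function.Injective f := hmono.injective.of_comp
  have hfP : ∀ i, f i ∈ P := fun i => hf ▸ Finset.mem_image_of_mem f (Finset.mem_univ i)
  set X : Fin n → ℝ := fun i => f i 0 + c * f i 1 with hX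
  have hXlt : ∀ {i j}, i < j → X i < X j := fun h => hmono h
  let slope : Fin n → Fin n → ℝ := fun i j => (f j 1 - f i 1) / (X j - X i)
  have hsymm : ∀ i j, slope i j = slope j i := fun i j => by
    simp only [slope]
    rw [← neg_sub (f i 1), ← neg_sub (X i), neg_div_neg_eq]
  -- The slope as a function of the unordered pair; the diagonal terms are `0 / 0 = 0`, so the sum
  -- is twice the slope.
  let s : Finset (Fin n) → ℝ := fun e => ∑ i ∈ e, ∑ j ∈ e, slope i j
  have hs : ∀ i j, i < j → s {i, j} = 2 * slope i j := by
    intro i j hij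
    have h0 : ∀ a, slope a a = 0 := fun a => by simp [slope]
    simp only [s, Finset.sum_pair hij.ne, h0, hsymm j i]
    ring
  -- Parallel pairs are ordered arbitrarily. Within a triple no two slopes agree, since no three
  -- points are collinear, so ties do not affect the triple condition.
  obtain ⟨T, h1, h2, h3⟩ :=
    exists_sorting ((Finset.univ : Finset (Fin n)).powersetCard 2) s
  have hT : ∀ {i j k l}, i < j → k < l →
      (f j 1 - f i 1) * (X l - X k) < (f l 1 - f k 1) * (X j - X i) → T {i, j} < T {k, l} := by
    intro i j k l hij hkl hlt
    apply h3 _ (pair_mem_powersetCard hij.ne) _ (pair_mem_powersetCard hkl.ne)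
    rw [hs i j hij, hs k l hkl]
    have : slope i j < slope k l :=
      (div_lt_div_iff₀ (sub_pos.2 (hXlt hij)) (sub_pos.2 (hXlt hkl))).2 hlt
    linarith
  refine ⟨f, T, hf, hinj, ?_, ?_, h2, ?_⟩
  · intro i j k hij hik hjk h
    exact hgen _ (hfP i) _ (hfP j) _ (hfP k) (hinj.ne hij) (hinj.ne hik) (hinj.ne hjk)
      (collinear_of_det_eq_zero (hinj.ne hij) h)
  · simpa [Finset.card_powersetCard] using h1
  · intro i j k hij hjk
    have hik := hij.trans hjk
    -- The shear leaves `det` unchanged, so each slope comparison within the triple is the sign of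
    -- the same determinant.
    refine ⟨fun h => ⟨hT hij hik ?_, hT hik hjk ?_⟩, fun h => ⟨hT hjk hik ?_, hT hik hij ?_⟩⟩ <;>
      simp only [det, hX] at h ⊢ <;> nlinarith

/-- When a pair is transposed, the elements before it are exactly the points below its line in the
sheared picture. So the position of the transposition shows how the line divides the other points.
-/
theorem exists_sequence {P : Finset Plane} (hP : P.card = n) (hn : 2 ≤ n)
    (hgen : GeneralPosition P) : ∃ S : AllowableSequence n, ∀ k, pointEdges P k = seqEdges S k := by
  classical
  obtain ⟨f, T, hf, hinj, hdet, hlt, hTinj, htri⟩ := exists_sweep hP hgen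
  have hT : IsSweep T := by
    refine ⟨hlt, hTinj, fun i j k hij hjk => ?_⟩
    rcases (hdet i j k hij.ne (hij.trans hjk).ne hjk.ne).lt_or_gt with h | h
    · exact .inr ((htri i j k hij hjk).2 h)
    · exact .inl ((htri i j k hij hjk).1 h)
  have h0 : 0 < n.choose 2 := Nat.choose_pos hn
  -- The line is directed from the right point `f j` to the left point `f i`, so that its left side
  -- is the lower one.
  have hbef : ∀ i j z, i < j → (Before T (T {i, j}) z i ↔ IsLeft (f j) (f i) (f z)) := by
    intro i j z hij
    rw [isLeft_iff]
    by_cases hzi : z = i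
    · subst hzi
      simp [det, show ¬ Before T (T {z, j}) z z from fun h => h.ne rfl]
      linarith
    by_cases hzj : z = j
    · subst hzj
      simp [det, (before_pair (T := T) hij).asymm]
    have hne := hdet i j z hij.ne (Ne.symm hzi) (Ne.symm hzj)
    have e1 : det (f j) (f i) (f z) = -det (f i) (f j) (f z) := det_swap_left _ _ _
    have e2 : det (f z) (f i) (f j) = det (f i) (f j) (f z) := (det_rotate _ _ _).symm
    have e3 : det (f i) (f z) (f j) = -det (f i) (f j) (f z) := by
      unfold det; ring
    rw [e1]
    unfold Before
    rcases lt_or_gt_of_ne hzi with h | h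
    · have := htri z i j h hij
      rw [e2] at this
      rcases hne.lt_or_gt with h' | h'
      · have := this.2 h'
        exact ⟨fun _ => by linarith, fun _ => .inl ⟨h, by omega⟩⟩
      · have := this.1 h'
        exact ⟨fun h => by omega, fun h => by linarith⟩
    · rcases lt_or_gt_of_ne hzj with hz | hz
      · have := htri i z j h hz
        rw [e3] at this
        rcases hne.lt_or_gt with h' | h'
        · have := this.1 (by linarith)
          exact ⟨fun _ => by linarith, fun _ => .inr ⟨h, by rw [Finset.pair_comm]; omega⟩⟩
        · have := this.2 (by linarith)
          rw [Finset.pair_comm z i]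
          exact ⟨fun h => by omega, fun h => by linarith⟩
      · have := htri i j z hij hz
        rw [Finset.pair_comm z i]
        rcases hne.lt_or_gt with h' | h'
        · have := this.2 h'
          exact ⟨fun _ => by linarith, fun _ => .inr ⟨h, by omega⟩⟩
        · have := this.1 h'
          exact ⟨fun h => by omega, fun h => by linarith⟩
  have hcount : ∀ i j, (P.filter fun r => IsLeft (f i) (f j) r).card =
      (Finset.univ.filter fun z => IsLeft (f i) (f j) (f z)).card := by
    intro i j
    rw [← hf, Finset.filter_image, Finset.card_image_of_injective _ hinj]
  have hright : ∀ i j, i < j → (P.filter fun r => IsLeft (f j) (f i) r).card =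
      sweepPos T (T {i, j}) i := by
    intro i j hij
    rw [hcount, sweepPos]
    congr 1
    apply Finset.filter_congr
    intro z _
    exact (hbef i j z hij).symm
  have hboth : ∀ i j, i < j → (P.filter fun r => IsLeft (f i) (f j) r).card +
      (P.filter fun r => IsLeft (f j) (f i) r).card + 2 = n := by
    intro i j hij
    have h : (Finset.univ : Finset (Fin n)) = {i, j} ∪
        ((Finset.univ.filter fun z => IsLeft (f i) (f j) (f z)) ∪
        (Finset.univ.filter fun z => IsLeft (f j) (f i) (f z))) := by
      ext z
      simp only [Finset.mem_univ, Finset.mem_union, Finset.mem_insert, Finset.mem_singleton,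
        Finset.mem_filter, true_and, true_iff]
      by_cases hzi : z = i
      · exact .inl (.inl hzi)
      by_cases hzj : z = j
      · exact .inl (.inr hzj)
      right
      rcases (hdet i j z hij.ne (Ne.symm hzi) (Ne.symm hzj)).lt_or_gt with h | h
      · right; rw [isLeft_iff, det_swap_left]; linarith
      · exact .inl h
    have h' := congrArg Finset.card h
    rw [Finset.card_union_of_disjoint, Finset.card_union_of_disjoint, Finset.card_pair hij.ne,
      ← hcount, ← hcount, Finset.card_univ, Fintype.card_fin] at h'
    · omega
    · rw [Finset.disjoint_filter]
      intro z _ h1 h2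
      rw [isLeft_iff] at h1 h2
      rw [det_swap_left] at h2
      linarith
    · rw [Finset.disjoint_left]
      intro z hz
      simp only [Finset.mem_insert, Finset.mem_singleton] at hz
      simp only [Finset.mem_union, Finset.mem_filter, Finset.mem_univ, true_and, isLeft_iff, det]
      rcases hz with rfl | rfl
      · rintro (h | h) <;> linarith
      · rintro (h | h) <;> linarith
  set S := hT.sequence h0 with hS
  have hpair : ∀ i j, i < j → ((0 : ℤ) ≤ (T {i, j} : ℕ) ∧ ((T {i, j} : ℕ) : ℤ) < S.half) ∧
      S.pair (T {i, j} : ℕ) = {i, j} ∧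
      S.pos (T {i, j} : ℕ) (S.fst (T {i, j} : ℕ)) = sweepPos T (T {i, j}) i := by
    intro i j hij
    have hl := hlt _ (pair_mem_powersetCard hij.ne)
    obtain ⟨h1, h2⟩ := hT.fst_snd_sequence h0 hij
    refine ⟨⟨by omega, by simp only [AllowableSequence.half]; omega⟩, ?_, ?_⟩
    · rw [AllowableSequence.pair, h1, h2]
    · rw [h1, hT.pos_sequence h0 hl.le]
  refine ⟨S, fun k => ?_⟩
  rw [AllowableSequence.seqEdges_eq, pointEdges]
  symm
  have hiff : ∀ i j, i < j → ((∃ p q : Plane, ({i, j} : Finset (Fin n)).image f = {p, q} ∧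
      (P.filter fun r => IsLeft p q r).card = k) ↔
      (sweepPos T (T {i, j}) i = k ∨ sweepPos T (T {i, j}) i + k + 2 = n)) := by
    intro i j hij
    have h1 := hright i j hij
    have h2 := hboth i j hij
    rw [Finset.image_insert, Finset.image_singleton]
    constructor
    · rintro ⟨p, q, hpq, hk⟩
      rw [← Finset.coe_inj, Finset.coe_pair, Finset.coe_pair, Set.pair_eq_pair_iff] at hpq
      rcases hpq with ⟨rfl, rfl⟩ | ⟨rfl, rfl⟩ <;> omega
    · rintro (h | h)
      · exact ⟨f j, f i, Finset.pair_comm _ _, by omega⟩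
      · exact ⟨f i, f j, rfl, by omega⟩
  have htime : ∀ t : ℤ, 0 ≤ t → t < S.half → ∃ i j, i < j ∧ t = (T {i, j} : ℕ) := by
    intro t h1 h2
    lift t to ℕ using h1
    obtain ⟨i, j, hij, h⟩ := hT.exists_pair (t := t) (by exact_mod_cast h2)
    exact ⟨i, j, hij, by rw [h]⟩
  refine Finset.card_bij (fun t _ => (S.pair t).image f) ?_ ?_ ?_
  · intro t ht
    obtain ⟨htI, ht⟩ := Finset.mem_filter.1 ht
    obtain ⟨i, j, hij, rfl⟩ := htime t (Finset.mem_Ico.1 htI).1 (Finset.mem_Ico.1 htI).2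
    obtain ⟨-, h2, h3⟩ := hpair i j hij
    rw [h3] at ht
    rw [h2, Finset.mem_filter, hiff i j hij, Finset.mem_powersetCard,
      Finset.card_image_of_injective _ hinj, Finset.card_pair hij.ne, ← hf]
    exact ⟨⟨Finset.image_subset_image (Finset.subset_univ _), rfl⟩, ht⟩
  · intro t ht t' ht' h
    have h1 := Finset.image_injective hinj h
    have hI := S.pair_injOn 0
    rw [zero_add] at hI
    exact hI (Finset.mem_coe.2 (Finset.mem_filter.1 ht).1)
      (Finset.mem_coe.2 (Finset.mem_filter.1 ht').1) h1
  · intro e he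
    obtain ⟨heP, hk⟩ := Finset.mem_filter.1 he
    obtain ⟨hsub, hcard⟩ := Finset.mem_powersetCard.1 heP
    obtain ⟨p, q, hpq, rfl⟩ := Finset.card_eq_two.1 hcard
    obtain ⟨i, -, rfl⟩ := Finset.mem_image.1 (hf ▸ hsub (by simp : p ∈ _))
    obtain ⟨j, -, rfl⟩ := Finset.mem_image.1 (hf ▸ hsub (by simp : q ∈ _))
    have hij : i ≠ j := fun h => hpq (by rw [h])
    rw [show ({f i, f j} : Finset Plane) = ({i, j} : Finset (Fin n)).image f by
      rw [Finset.image_insert, Finset.image_singleton]] at hk ⊢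
    clear hpq hcard hsub heP he
    wlog hlt : i < j generalizing i j with H
    · rw [Finset.pair_comm] at hk ⊢
      exact H j i hk hij.symm (lt_of_le_of_ne (not_lt.1 hlt) hij.symm)
    obtain ⟨h1, h2, h3⟩ := hpair i j hlt
    refine ⟨(T {i, j} : ℕ), ?_, by rw [h2]⟩
    rw [Finset.mem_filter, Finset.mem_Ico, h3]
    exact ⟨h1, (hiff i j hlt).1 hk⟩

/-- Points on a parabola are in general position. -/
theorem exists_generalPosition (n : ℕ) : ∃ P : Finset Plane, P.card = n ∧ GeneralPosition P := by
  classical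
  let f : Fin n → Plane := fun i => !₂[(i : ℝ), (i : ℝ) ^ 2]
  have h0 : ∀ i, f i 0 = (i : ℝ) := fun i => by simp [f]
  have h1 : ∀ i, f i 1 = (i : ℝ) ^ 2 := fun i => by simp [f]
  have hinj : Function.Injective f := by
    intro i j h
    have := congrArg (fun p : Plane => p 0) h
    simp only [h0] at this
    exact Fin.ext (by exact_mod_cast this)
  refine ⟨Finset.univ.image f, by rw [Finset.card_image_of_injective _ hinj]; simp, ?_⟩
  intro p hp q hq r hr hpq hpr hqr hcol
  obtain ⟨i, -, rfl⟩ := Finset.mem_image.1 hp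
  obtain ⟨j, -, rfl⟩ := Finset.mem_image.1 hq
  obtain ⟨k, -, rfl⟩ := Finset.mem_image.1 hr
  have hne : ∀ a b : Fin n, f a ≠ f b → (a : ℝ) - b ≠ 0 := by
    intro a b hab h
    exact hab (by rw [show a = b from Fin.ext (by exact_mod_cast sub_eq_zero.1 h)])
  have hd := det_eq_zero_of_collinear hcol
  simp only [det, h0, h1] at hd
  have : ((j : ℝ) - i) * ((k : ℝ) - i) * ((k : ℝ) - j) = 0 := by linarith
  rcases mul_eq_zero.1 this with h | h
  · rcases mul_eq_zero.1 h with h | h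
    · exact hne j i hpq.symm h
    · exact hne k i hpr.symm h
  · exact hne k j hqr.symm h

theorem pointEdgesLE_eq {P : Finset Plane} {S : AllowableSequence n}
    (h : ∀ k, pointEdges P k = seqEdges S k) (k : ℕ) : pointEdgesLE P k = seqEdgesLE S k :=
  Finset.sum_congr rfl fun j _ => h j

end KEdges

/-! ### The bound for both minima. -/

theorem mainTheorem4 (n k : ℕ) (hmk : KEdges.startIndex n - 1 ≤ (k : ℤ))
    (hkn : (k : ℚ) ≤ ((n : ℚ) - 3) / 2) :
    KEdges.u n k ≤ (KEdges.minPointEdgesLE n k : ℚ) ∧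
      KEdges.u n k ≤ (KEdges.minSeqEdgesLE n k : ℚ) := by
  have hk : 2 * k + 3 ≤ n := by
    have : ((2 * k + 3 : ℕ) : ℚ) ≤ n := by push_cast; linarith
    exact_mod_cast this
  -- The infimum of an empty set of naturals is 0, so both minima need a witness in order to be
  -- attained.
  obtain ⟨P₀, hP₀, hgen₀⟩ := KEdges.exists_generalPosition n
  obtain ⟨S₀, -⟩ := KEdges.exists_sequence hP₀ (by omega) hgen₀
  constructor
  · obtain ⟨P, hP, hgen, he⟩ := Nat.sInf_mem (s := {e | ∃ P : Finset KEdges.Plane, P.card = n ∧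
      KEdges.GeneralPosition P ∧ e = KEdges.pointEdgesLE P k}) ⟨_, P₀, hP₀, hgen₀, rfl⟩
    obtain ⟨S, hS⟩ := KEdges.exists_sequence hP (by omega) hgen
    rw [KEdges.minPointEdgesLE, he, KEdges.pointEdgesLE_eq hS]
    exact KEdges.u_le_seqEdgesLE S hmk hk
  · obtain ⟨S, he⟩ := Nat.sInf_mem (s := {e | ∃ S : KEdges.AllowableSequence n,
      e = KEdges.seqEdgesLE S k}) ⟨_, S₀, rfl⟩
    rw [KEdges.minSeqEdgesLE, he]
    exact KEdges.u_le_seqEdgesLE S hmk hk
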